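/- **Setting.** Let $L,M,T\ge 0$ be integers and let $\mathbb A_j,\mathbb B_j,\mathbb V_j$, $j\in\mathbb Z$, be nonempty standard Borel spaces (for instance Polish spaces). Write $x_k^i=(x_k,\dots,x_i)$ (empty if $k>i$) and $x^i=x_0^i$; entries with negative index are the fixed initial data $a_{-L}^{-1},b_{-M}^{-1},v_{-T}^{-1}$, known to encoder and decoder. Consider the channel $$B_i=h_i(B_{i-M}^{i-1},A_{i-L}^{i},V_i),\qquad i=0,1,\dots,$$ with $h_i$ measurable, such that $v_i\mapsto h_i(b_{i-M}^{i-1},a_{i-L}^i,v_i)$ has a (jointly) measurable inverse $\bar h_i(b_i,b_{i-M}^{i-1},a_{i-L}^i)$, i.e. $\bar h_i(h_i(b_{i-M}^{i-1},a_{i-L}^i,v_i),b_{i-M}^{i-1},a_{i-L}^i)=v_i$, and with noise satisfying $\mathbf P(dv_i\mid v^{i-1},a^i)=\mathbf P(dv_i\mid v_{i-T}^{i-1})$, where $\mathbf P(dv_i\mid v_{i-T}^{i-1})$ are given stochastic kernels. Let $\gamma_i(a_{i-L}^i,b_{i-M}^i)\in[0,\infty)$ be measurable and $\kappa\in[0,\infty)$.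 Let $Q_i(db_i\mid b_{i-M}^{i-1},a_{i-L}^i,v_{i-T}^{i-1})$ be the law of $h_i(b_{i-M}^{i-1},a_{i-L}^i,V_i)$ for $V_i\sim\mathbf P(\cdot\mid v_{i-T}^{i-1})$. An input distribution $\bar P=\{\bar P_i(da_i\mid a^{i-1},v^{i-1},b^{i-1})\}$ induces the joint law $\mathbf P^{\bar P}$ in which, given the past $(a^{i-1},v^{i-1},b^{i-1})$, $A_i\sim \bar P_i$ and $V_i\sim\mathbf P(\cdot\mid v_{i-T}^{i-1})$ are drawn independently and then $B_i$ is given by the recursion. Let $\bar{\mathcal P}_{[0,n]}(\kappa)$ be the set of $\bar P$ with $\frac1{n+1}\sum_{i=0}^n\mathbf E^{\bar P}\gamma_i(A_{i-L}^i,B_{i-M}^i)\le\kappa$, and $$C_n(\kappa)=\sup_{\bar P\in\bar{\mathcal P}_{[0,n]}(\kappa)}\ \sum_{i=0}^n I(A_{i-L}^i,V_{i-T}^{i-1};B_i\mid B^{i-1})\in[0,\infty],$$ where $I(\cdot;\cdot\mid\cdot)$ is conditional mutual information in nats. A feedback code of block length $n+1$ has $M_n\ge1$ equiprobable messages $w$,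 a measurable encoder $a_i=g_i(w,a^{i-1},b^{i-1})$, $0\le i\le n$, with average cost at most $\kappa$, and a measurable decoder of $B^n$. A rate $R$ is achievable if there are codes for all $n$ with error probabilities $\le\epsilon_n\to0$ and $\liminf_n\frac1{n+1}\log M_n\ge R$. Let $\bar E_n(\kappa,K)$ be the supremum of $\frac1{n+1}\sum_{i=0}^nI(A_{i-L}^i,V_{i-T}^{i-1};B_i\mid B^{i-1})$ over measurable encoding strategies $a_i=\bar g_i(w,a^{i-1},v^{i-1},b^{i-1})$, $w$ uniform on $K$ messages, with average cost (up to time $n$) at most $\kappa$. **Theorem.** (1) *Converse coding theorem.* Assume that (a) for every $n$ the supremum $C_n(\kappa)$ is attained, and (b) $\liminf_n\frac1{n+1}C_n(\kappa)<\infty$. Then for every sequence of feedback codes with error probabilities $\le\epsilon_n\to0$, $$\liminf_n\tfrac1{n+1}\log M_n\le\liminf_n\bar E_n(\kappa,M_n)\le\liminf_n\tfrac1{n+1}C_n(\kappa),$$ and hence every achievable rate satisfies $R\le\liminf_n\frac1{n+1}C_n(\kappa)$. Moreover, for every $\bar P$ and $i$ (without assuming (a), (b)): - $\mathbf P^{\bar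 P}(da^{i},dv^{i},db^{i})=\bigotimes_{j\le i}Q_j(db_j\mid b_{j-M}^{j-1},a_{j-L}^j,v_{j-T}^{j-1})\otimes\bar P_j(da_j\mid a^{j-1},v^{j-1},b^{j-1})\otimes\delta_{\bar h_j(b_j,b_{j-M}^{j-1},a_{j-L}^j)}(dv_j)$; - the conditional distribution of $B_i$ given $B^{i-1}$ is $\Pi_i^{\bar P}(db_i\mid b^{i-1})=\int Q_i(db_i\mid b_{i-M}^{i-1},a_{i-L}^i,v_{i-T}^{i-1})\,\bar P_i(da_i\mid a^{i-1},v^{i-1},b^{i-1})\,\mathbf P^{\bar P}(da^{i-1},dv^{i-1}\mid b^{i-1})$; - $I(A_{i-L}^i,V_{i-T}^{i-1};B_i\mid B^{i-1})=\mathbf E^{\bar P}\log\frac{dQ_i(\cdot\mid B_{i-M}^{i-1},A_{i-L}^i,V_{i-T}^{i-1})}{d\Pi_i^{\bar P}(\cdot\mid B^{i-1})}(B_i)$, which is read as $+\infty$ if absolute continuity or integrability fails. For every $n$, $C_n(\kappa)$ is unchanged if the supremum is restricted to input distributions $P_i(da_i\mid a^{i-1},b^{i-1})$. (2) *Information structures.*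 Whenever some $\bar P\in\bar{\mathcal P}_{[0,n]}(\kappa)$ attains $C_n(\kappa)$, it is also attained by an element of $\bar{\mathcal P}_{[0,n]}(\kappa)$ of the form $\pi_i(da_i\mid a_{i-L}^{i-1},v_{i-T}^{i-1},b^{i-1})$, where for $i\le n$ one can take for $\pi_i$ the conditional distribution of $A_i$ given $(A_{i-L}^{i-1},V_{i-T}^{i-1},B^{i-1})$ under $\mathbf P^{\bar P}$. For every $n$ (whether or not the supremum is attained) $$C_n(\kappa)=\sup_{\pi}\ \sum_{i=0}^n\mathbf E^{\pi}\log\frac{dQ_i(\cdot\mid B_{i-M}^{i-1},A_{i-L}^i,V_{i-T}^{i-1})}{d\Pi_i^{\pi}(\cdot\mid B^{i-1})}(B_i),$$ the supremum being over $\pi=\{\pi_i(da_i\mid a_{i-L}^{i-1},v_{i-T}^{i-1},b^{i-1})\}$ with average cost up to time $n$ at most $\kappa$. For every such family $\pi$ of kernels, and every $i$, the joint law is the product above with $\bar P_j=\pi_j$; the conditional distribution of $B_i$ given $B^{i-1}$ is $$\Pi_i^\pi(db_i\mid b^{i-1})=\int Q_i(db_i\mid b_{i-M}^{i-1},a_{i-L}^i,v_{i-T}^{i-1})\,\pi_i(da_i\mid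 a_{i-L}^{i-1},v_{i-T}^{i-1},b^{i-1})\,\mathbf P^\pi(da_{i-L}^{i-1},dv_{i-T}^{i-1}\mid b^{i-1});$$ the $i$-th expectation above equals $I(A_{i-L}^i,V_{i-T}^{i-1};B_i\mid B^{i-1})$ under $\mathbf P^\pi$; and the a posteriori distributions $\xi_i(b^{i-1})=\mathbf P^\pi(da_{i-L}^{i-1},dv_{i-T}^{i-1}\mid b^{i-1})$ satisfy the recursion: $\xi_0$ is the point mass at the initial data, and, for almost all $b^{i-1}$ and $\Pi_i^\pi(\cdot\mid b^{i-1})$-almost all $b_i$, $\xi_{i+1}(b^{i})$ is the conditional distribution given $b_i$ of $(a_{i+1-L}^{i},v_{i+1-T}^{i})$ when $(a_{i-L}^{i-1},v_{i-T}^{i-1})\sim\xi_i(b^{i-1})$, $a_i\sim\pi_i(\cdot\mid a_{i-L}^{i-1},v_{i-T}^{i-1},b^{i-1})$, $b_i\sim Q_i(\cdot\mid b_{i-M}^{i-1},a_{i-L}^i,v_{i-T}^{i-1})$ and $v_i=\bar h_i(b_i,b_{i-M}^{i-1},a_{i-L}^i)$. -/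

import Mathlib

open MeasureTheory ProbabilityTheory InformationTheory Filter Topology
open scoped ENNReal NNReal

noncomputable section

namespace NCMD

/-! ### Conditional mutual information and expected log-densities -/

section Information

variable {Ω S U Z W : Type*} [MeasurableSpace Ω] [MeasurableSpace S] [MeasurableSpace U]
  [MeasurableSpace Z] [MeasurableSpace W]

/-- The conditional mutual information `I(U; Z | W)` under `μ`, with values in `[0, ∞]` (in nats):
the relative entropy of the law of `(W, (U, Z))` with respect to
`P_W(dw) ⊗ (P_{U|W}(du|w) × P_{Z|W}(dz|w))`. -/
def condMutualInfo [StandardBorelSpace U] [Nonempty U] [StandardBorelSpace Z] [Nonempty Z]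
    (μ : Measure Ω) [IsFiniteMeasure μ] (u : Ω → U) (z : Ω → Z) (w : Ω → W) : ℝ≥0∞ :=
  klDiv (μ.map fun ω => (w ω, (u ω, z ω)))
    ((μ.map w) ⊗ₘ (condDistrib u w μ ×ₖ condDistrib z w μ))

open Classical in
/-- The expectation `E_μ [ log ( dq(·|s) / dη(·|s) (z) ) ]` for random elements `s`, `z` such that
`q` is the conditional law of `z` given `s`; it is `+∞` if absolute continuity fails or if the
logarithm (whose negative part is always integrable) is not integrable. `Kernel.rnDeriv` is the
jointly measurable version of the Radon-Nikodym derivative. -/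
def expLogDensity [MeasurableSpace.CountableOrCountablyGenerated S Z] (μ : Measure Ω)
    (s : Ω → S) (z : Ω → Z) (q η : Kernel S Z) : ℝ≥0∞ :=
  if (∀ᵐ x ∂(μ.map s), q x ≪ η x) ∧
      Integrable (fun ω => Real.log (Kernel.rnDeriv q η (s ω) (z ω)).toReal) μ then
    ENNReal.ofReal (∫ ω, Real.log (Kernel.rnDeriv q η (s ω) (z ω)).toReal ∂μ)
  else ⊤

end Information

/-! ### Strings and windows of symbols

Alphabets are families indexed by `ℤ`; transmission starts at time `0`. -/

/-- Strings `x^{i-1} = (x_0, …, x_{i-1})`. -/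
abbrev Past (X : ℤ → Type*) (i : ℕ) : Type _ := (j : Fin i) → X ((j : ℕ) : ℤ)

/-- Windows `x_{i-m}^{i-1} = (x_{i-m}, …, x_{i-1})`; in particular `Win X m 0` is the type of
initial data `x_{-m}^{-1}`. -/
abbrev Win (X : ℤ → Type*) (m i : ℕ) : Type _ :=
  (j : Set.Ico ((i : ℤ) - (m : ℤ)) (i : ℤ)) → X j

section Windows

variable {X : ℤ → Type*} {m : ℕ}

/-- The window `x_{i-m}^{i-1}` of the sequence with initial data `x_{-m}^{-1} = x0` and
`x^{i-1} = x`. -/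
def win (x0 : Win X m 0) (i : ℕ) (x : Past X i) : Win X m i := fun j =>
  match j with
  | ⟨Int.ofNat k, hk⟩ => x ⟨k, by have := hk.2; simp at this; omega⟩
  | ⟨Int.negSucc k, hk⟩ => x0 ⟨Int.negSucc k, by
      have := hk.1; simp only [Set.mem_Ico]; push_cast; omega⟩

/-- From `x_{i-m}^{i-1}` and `x_i` to `x_{i+1-m}^{i}`. -/
def push {i : ℕ} (w : Win X m i) (x : X (i : ℤ)) : Win X m (i + 1) := fun j =>
  if h : j.1 < (i : ℤ) then
    w ⟨j.1, by have := j.2.1; simp only [Set.mem_Ico]; push_cast at this; omega⟩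
  else cast (congrArg X (by have := j.2.2; push_cast at this; omega)) x

/-- From `x^{i-1}` and `x_i` to `x^i`. -/
def append {i : ℕ} (x : Past X i) (y : X (i : ℤ)) : Past X (i + 1) :=
  Fin.snoc (α := fun j : Fin (i + 1) => X ((j : ℕ) : ℤ)) x y

/-- From `x^i` to `x^{i-1}`. -/
def dropLast {i : ℕ} (x : Past X (i + 1)) : Past X i := fun j => x j.castSucc

/-- From `x^i` to `x_i`. -/
def last {i : ℕ} (x : Past X (i + 1)) : X (i : ℤ) := x (Fin.last i)

variable [∀ j, MeasurableSpace (X j)]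

@[fun_prop]
lemma measurable_win (x0 : Win X m 0) (i : ℕ) : Measurable (win x0 i) := by
  refine measurable_pi_lambda _ fun j => ?_
  match j with
  | ⟨Int.ofNat k, hk⟩ => exact measurable_pi_apply _
  | ⟨Int.negSucc k, hk⟩ => exact measurable_const

@[fun_prop]
lemma measurable_append {i : ℕ} :
    Measurable fun p : Past X i × X (i : ℤ) => append p.1 p.2 := by
  refine measurable_pi_lambda _ fun j => ?_
  refine Fin.lastCases ?_ (fun k => ?_) j
  · have : (fun p : Past X i × X (i : ℤ) => append p.1 p.2 (Fin.last i)) = fun p => p.2 := by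
      funext p; exact Fin.snoc_last (α := fun j : Fin (i + 1) => X ((j : ℕ) : ℤ)) _ _
    rw [this]; exact measurable_snd
  · have : (fun p : Past X i × X (i : ℤ) => append p.1 p.2 k.castSucc) = fun p => p.1 k := by
      funext p; exact Fin.snoc_castSucc (α := fun j : Fin (i + 1) => X ((j : ℕ) : ℤ)) _ _ _
    rw [this]; exact (measurable_pi_apply k).comp measurable_fst

end Windows

/-! ### The channel model -/

/-- A nonlinear channel model with correlated noise, for the alphabets `A` (inputs), `B` (outputs),
`V` (noise), and memories `L`, `M`, `T`. -/
structure Model (A B V : ℤ → Type*) [∀ j, MeasurableSpace (A j)] [∀ j, MeasurableSpace (B j)]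
    [∀ j, MeasurableSpace (V j)] (L M T : ℕ) where
  /-- initial data `a_{-L}^{-1}` -/
  a0 : Win A L 0
  /-- initial data `b_{-M}^{-1}` -/
  b0 : Win B M 0
  /-- initial data `v_{-T}^{-1}` -/
  v0 : Win V T 0
  /-- the recursion `B_i = h_i(B_{i-M}^{i-1}, (A_{i-L}^{i-1}, A_i), V_i)` -/
  h : (i : ℕ) → Win B M i → Win A L i → A (i : ℤ) → V (i : ℤ) → B (i : ℤ)
  measurable_h : ∀ i : ℕ, Measurable
    fun x : Win B M i × Win A L i × A (i : ℤ) × V (i : ℤ) => h i x.1 x.2.1 x.2.2.1 x.2.2.2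
  /-- the inverse of `v_i ↦ h_i(b_{i-M}^{i-1}, a_{i-L}^i, v_i)`; surjectivity is not required, so
  only the values on the range matter -/
  hinv : (i : ℕ) → B (i : ℤ) → Win B M i → Win A L i → A (i : ℤ) → V (i : ℤ)
  measurable_hinv : ∀ i : ℕ, Measurable
    fun x : B (i : ℤ) × Win B M i × Win A L i × A (i : ℤ) => hinv i x.1 x.2.1 x.2.2.1 x.2.2.2
  hinv_h : ∀ (i : ℕ) (b : Win B M i) (a : Win A L i) (x : A (i : ℤ)) (v : V (i : ℤ)),
    hinv i (h i b a x v) b a x = v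
  /-- the noise distributions `P(dv_i | v_{i-T}^{i-1})` -/
  noise : (i : ℕ) → Kernel (Win V T i) (V (i : ℤ))
  markov_noise : ∀ i : ℕ, IsMarkovKernel (noise i)
  /-- the transmission costs `γ_i((A_{i-L}^{i-1}, A_i), (B_{i-M}^{i-1}, B_i))` -/
  γ : (i : ℕ) → Win A L i → A (i : ℤ) → Win B M i → B (i : ℤ) → ℝ≥0
  measurable_γ : ∀ i : ℕ, Measurable
    fun x : Win A L i × A (i : ℤ) × Win B M i × B (i : ℤ) => γ i x.1 x.2.1 x.2.2.1 x.2.2.2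

attribute [instance] Model.markov_noise

/-- Histories `(a^{i-1}, v^{i-1}, b^{i-1})`. -/
abbrev Hist (A B V : ℤ → Type*) (i : ℕ) : Type _ := Past A i × Past V i × Past B i

/-- Symbols `(a_i, v_i, b_i)`. -/
abbrev Sym (A B V : ℤ → Type*) (i : ℕ) : Type _ := A (i : ℤ) × V (i : ℤ) × B (i : ℤ)

/-- From `(a^i, v^i, b^i)` to `(a^{i-1}, v^{i-1}, b^{i-1})`. -/
def prev {A B V : ℤ → Type*} {i : ℕ} (x : Hist A B V (i + 1)) : Hist A B V i :=
  (dropLast x.1, dropLast x.2.1, dropLast x.2.2)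

section Laws

variable {A B V : ℤ → Type*} [∀ j, MeasurableSpace (A j)] [∀ j, MeasurableSpace (B j)]
  [∀ j, MeasurableSpace (V j)]

/-- The joint law of `(a^{i-1}, v^{i-1}, b^{i-1})` when `(a_j, v_j, b_j)` is drawn from
`step j` given `(a^{j-1}, v^{j-1}, b^{j-1})`, for `j = 0, 1, …, i-1`. -/
def trajLaw (step : (i : ℕ) → Kernel (Hist A B V i) (Sym A B V i)) :
    (i : ℕ) → Measure (Hist A B V i)
  | 0 => Measure.dirac (fun j => j.elim0, fun j => j.elim0, fun j => j.elim0)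
  | i + 1 => ((trajLaw step i) ⊗ₘ (step i)).map fun x =>
      (append x.1.1 x.2.1, append x.1.2.1 x.2.2.1, append x.1.2.2 x.2.2.2)

lemma isProbabilityMeasure_trajLaw (step : (i : ℕ) → Kernel (Hist A B V i) (Sym A B V i))
    (hs : ∀ i, IsMarkovKernel (step i)) (i : ℕ) : IsProbabilityMeasure (trajLaw step i) := by
  induction i with
  | zero => unfold trajLaw; infer_instance
  | succ i ih =>
    have := hs i
    unfold trajLaw
    refine Measure.isProbabilityMeasure_map (Measurable.aemeasurable ?_)
    have h1 : Measurable fun x : Hist A B V i × Sym A B V i => append x.1.1 x.2.1 :=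
      measurable_append.comp (f := fun x : Hist A B V i × Sym A B V i => (x.1.1, x.2.1)) (by fun_prop)
    have h2 : Measurable fun x : Hist A B V i × Sym A B V i => append x.1.2.1 x.2.2.1 :=
      measurable_append.comp (f := fun x : Hist A B V i × Sym A B V i => (x.1.2.1, x.2.2.1)) (by fun_prop)
    have h3 : Measurable fun x : Hist A B V i × Sym A B V i => append x.1.2.2 x.2.2.2 :=
      measurable_append.comp (f := fun x : Hist A B V i × Sym A B V i => (x.1.2.2, x.2.2.2)) (by fun_prop)
    exact h1.prodMk (h2.prodMk h3)

end Laws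

section Inputs

variable (A B V : ℤ → Type*) [∀ j, MeasurableSpace (A j)] [∀ j, MeasurableSpace (B j)]
  [∀ j, MeasurableSpace (V j)]

/-- Channel input distributions `P_i(da_i | a^{i-1}, v^{i-1}, b^{i-1})`. For transmission over
`0, …, n` only the members with `i ≤ n` matter. -/
structure InputD where
  ker : (i : ℕ) → Kernel (Hist A B V i) (A (i : ℤ))
  markov : ∀ i : ℕ, IsMarkovKernel (ker i)

/-- Channel input distributions `P_i(da_i | a^{i-1}, b^{i-1})`. -/
structure InputC where
  ker : (i : ℕ) → Kernel (Past A i × Past B i) (A (i : ℤ))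
  markov : ∀ i : ℕ, IsMarkovKernel (ker i)

/-- Channel input distributions `π_i(da_i | a_{i-L}^{i-1}, v_{i-T}^{i-1}, b^{i-1})`. -/
structure InputLT (L T : ℕ) where
  ker : (i : ℕ) → Kernel (Win A L i × Win V T i × Past B i) (A (i : ℤ))
  markov : ∀ i : ℕ, IsMarkovKernel (ker i)

attribute [instance] InputD.markov InputC.markov InputLT.markov

/-- Encoding strategies `a_i = g_i(w, a^{i-1}, v^{i-1}, b^{i-1})` for `K` messages. -/
structure EncoderD (K : ℕ) where
  enc : (i : ℕ) → Fin K → Hist A B V i → A (i : ℤ)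
  measurable_enc : ∀ (i : ℕ) (w : Fin K), Measurable (enc i w)

/-- Feedback encoding strategies `a_i = g_i(w, a^{i-1}, b^{i-1})` for `K` messages. -/
structure EncoderFB (K : ℕ) where
  enc : (i : ℕ) → Fin K → Past A i × Past B i → A (i : ℤ)
  measurable_enc : ∀ (i : ℕ) (w : Fin K), Measurable (enc i w)

end Inputs

section Lifts

variable {A B V : ℤ → Type*} [∀ j, MeasurableSpace (A j)] [∀ j, MeasurableSpace (B j)]
  [∀ j, MeasurableSpace (V j)]

/-- The input distribution `P_i(da_i | a^{i-1}, b^{i-1})`, seen as one that ignores `v^{i-1}`. -/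
def InputC.toD (p : InputC A B) : InputD A B V where
  ker i := (p.ker i).comap (fun x => (x.1, x.2.2)) (by fun_prop)
  markov _ := inferInstance

/-- The input distribution with `a_i = g_i(w, a^{i-1}, v^{i-1}, b^{i-1})`, for the message `w`. -/
def EncoderD.toInput {K : ℕ} (g : EncoderD A B V K) (w : Fin K) : InputD A B V where
  ker i := Kernel.deterministic (g.enc i w) (g.measurable_enc i w)
  markov _ := inferInstance

/-- A feedback encoding strategy, seen as one that ignores `v^{i-1}`. -/
def EncoderFB.toD {K : ℕ} (g : EncoderFB A B K) : EncoderD A B V K where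
  enc i w x := g.enc i w (x.1, x.2.2)
  measurable_enc i w := (g.measurable_enc i w).comp (by fun_prop)

end Lifts

namespace Model

variable {A B V : ℤ → Type*} [∀ j, MeasurableSpace (A j)] [∀ j, MeasurableSpace (B j)]
  [∀ j, MeasurableSpace (V j)] {L M T : ℕ} (m : Model A B V L M T)

/-- `a_{i-L}^{i-1}` as a function of the history. -/
def aWin {i : ℕ} (x : Hist A B V i) : Win A L i := win m.a0 i x.1

/-- `v_{i-T}^{i-1}` as a function of the history. -/
def vWin {i : ℕ} (x : Hist A B V i) : Win V T i := win m.v0 i x.2.1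

/-- `b_{i-M}^{i-1}` as a function of `b^{i-1}`. -/
def bWin {i : ℕ} (b : Past B i) : Win B M i := win m.b0 i b

@[fun_prop]
lemma measurable_aWin (i : ℕ) : Measurable (m.aWin (i := i)) := by unfold aWin; fun_prop

@[fun_prop]
lemma measurable_vWin (i : ℕ) : Measurable (m.vWin (i := i)) := by unfold vWin; fun_prop

@[fun_prop]
lemma measurable_bWin (i : ℕ) : Measurable (m.bWin (i := i)) := by unfold bWin; fun_prop

/-- The input distribution `π_i(da_i | a_{i-L}^{i-1}, v_{i-T}^{i-1}, b^{i-1})`, seen as a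
distribution given `(a^{i-1}, v^{i-1}, b^{i-1})`. -/
def liftLT (p : InputLT A B V L T) : InputD A B V where
  ker i := (p.ker i).comap (fun x => (m.aWin x, m.vWin x, x.2.2)) (by fun_prop)
  markov _ := inferInstance

/-! #### Joint laws -/

/-- Given the history, `a_i` is drawn from the input distribution and, independently of it, `v_i`
from `P(dv_i | v_{i-T}^{i-1})`; then `b_i = h_i(b_{i-M}^{i-1}, a_{i-L}^i, v_i)`. -/
def step (p : InputD A B V) (i : ℕ) : Kernel (Hist A B V i) (Sym A B V i) :=
  (Kernel.id ×ₖ (p.ker i ×ₖ (m.noise i).comap m.vWin (m.measurable_vWin i))).map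
    fun x => (x.2.1, x.2.2, m.h i (m.bWin x.1.2.2) (m.aWin x.1) x.2.1 x.2.2)

lemma isMarkovKernel_step (p : InputD A B V) (i : ℕ) : IsMarkovKernel (m.step p i) := by
  refine Kernel.IsMarkovKernel.map _ ?_
  have : Measurable fun x : Hist A B V i × A (i : ℤ) × V (i : ℤ) =>
      m.h i (m.bWin x.1.2.2) (m.aWin x.1) x.2.1 x.2.2 :=
    (m.measurable_h i).comp (f := fun x : Hist A B V i × A (i : ℤ) × V (i : ℤ) =>
      (m.bWin x.1.2.2, m.aWin x.1, x.2.1, x.2.2)) (by fun_prop)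
  fun_prop

/-- The joint law of `(a^{i-1}, v^{i-1}, b^{i-1})` induced by the input distribution `p`. -/
def law (p : InputD A B V) (i : ℕ) : Measure (Hist A B V i) := trajLaw (m.step p) i

instance (p : InputD A B V) (i : ℕ) : IsProbabilityMeasure (m.law p i) :=
  isProbabilityMeasure_trajLaw _ (m.isMarkovKernel_step p) i

/-- The joint law of `(a^{i-1}, v^{i-1}, b^{i-1})` induced by the encoding strategy `g`, when the
message is uniformly distributed on the `K` messages. -/
def encLaw {K : ℕ} (g : EncoderD A B V K) (i : ℕ) : Measure (Hist A B V i) :=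
  ∑ w : Fin K, (K : ℝ≥0)⁻¹ • m.law (g.toInput w) i

instance {K : ℕ} (g : EncoderD A B V K) (i : ℕ) : IsFiniteMeasure (m.encLaw g i) := by
  unfold encLaw; infer_instance

/-! #### Costs and information, for a family of joint laws of `(a^{i-1}, v^{i-1}, b^{i-1})` -/

/-- The average cost `(1/(n+1)) ∑_{i=0}^n E γ_i(A_{i-L}^i, B_{i-M}^i)`. -/
def avgCost (ρ : (i : ℕ) → Measure (Hist A B V i)) (n : ℕ) : ℝ≥0∞ :=
  (∑ i ∈ Finset.range (n + 1), ∫⁻ x,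
    (m.γ i (m.aWin (prev x)) (last x.1) (m.bWin (prev x).2.2) (last x.2.2) : ℝ≥0∞) ∂ρ (i + 1))
      / (n + 1)

variable [∀ j, StandardBorelSpace (A j)] [∀ j, StandardBorelSpace (B j)]
  [∀ j, StandardBorelSpace (V j)] [∀ j, Nonempty (A j)] [∀ j, Nonempty (B j)]
  [∀ j, Nonempty (V j)]

/-- `I(A_{i-L}^i, V_{i-T}^{i-1}; B_i | B^{i-1})`. -/
def info (ρ : (i : ℕ) → Measure (Hist A B V i)) [∀ i, IsFiniteMeasure (ρ i)] (i : ℕ) : ℝ≥0∞ :=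
  condMutualInfo (ρ (i + 1))
    (fun x => ((m.aWin (prev x), last x.1), m.vWin (prev x))) (fun x => last x.2.2)
    (fun x => (prev x).2.2)

/-- `∑_{i=0}^n I(A_{i-L}^i, V_{i-T}^{i-1}; B_i | B^{i-1})`. -/
def sumInfo (ρ : (i : ℕ) → Measure (Hist A B V i)) [∀ i, IsFiniteMeasure (ρ i)] (n : ℕ) : ℝ≥0∞ :=
  ∑ i ∈ Finset.range (n + 1), m.info ρ i

/-- The supremum of `(1/(n+1)) ∑_{i=0}^n I(A_{i-L}^i, V_{i-T}^{i-1}; B_i | B^{i-1})` over the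
encoding strategies `a_i = g_i(w, a^{i-1}, v^{i-1}, b^{i-1})` for `K` uniformly distributed messages
whose average cost up to time `n` is at most `κ`. -/
def encoderBound (κ : ℝ≥0) (K n : ℕ) : ℝ≥0∞ :=
  ⨆ (g : EncoderD A B V K) (_ : m.avgCost (m.encLaw g) n ≤ κ), m.sumInfo (m.encLaw g) n / (n + 1)

/-- The supremum of `∑_{i=0}^n I(A_{i-L}^i, V_{i-T}^{i-1}; B_i | B^{i-1})` over the input
distributions `P_i(da_i | a^{i-1}, v^{i-1}, b^{i-1})` whose average cost up to time `n` is at most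
`κ`. -/
def capD (κ : ℝ≥0) (n : ℕ) : ℝ≥0∞ :=
  ⨆ (p : InputD A B V) (_ : m.avgCost (m.law p) n ≤ κ), m.sumInfo (m.law p) n

/-- The same supremum over the input distributions `P_i(da_i | a^{i-1}, b^{i-1})`. -/
def capC (κ : ℝ≥0) (n : ℕ) : ℝ≥0∞ :=
  ⨆ (p : InputC A B) (_ : m.avgCost (m.law p.toD) n ≤ κ), m.sumInfo (m.law p.toD) n

/-- `p` attains the supremum `capD κ n`. -/
def IsOptimal (κ : ℝ≥0) (n : ℕ) (p : InputD A B V) : Prop :=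
  m.avgCost (m.law p) n ≤ κ ∧ m.sumInfo (m.law p) n = m.capD κ n

/-! #### Channel distributions, output distributions, a posteriori distributions -/

/-- The channel distribution `Q_i(db_i | b_{i-M}^{i-1}, a_{i-L}^i, v_{i-T}^{i-1})`: the law of
`h_i(b_{i-M}^{i-1}, a_{i-L}^i, V_i)` with `V_i` drawn from `P(dv_i | v_{i-T}^{i-1})`. -/
def Q (i : ℕ) : Kernel (Win B M i × Win A L i × A (i : ℤ) × Win V T i) (B (i : ℤ)) :=
  (Kernel.id ×ₖ (m.noise i).comap (fun s => s.2.2.2) (by fun_prop)).map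
    fun x => m.h i x.1.1 x.1.2.1 x.1.2.2.1 x.2

instance (i : ℕ) : IsMarkovKernel (m.Q i) := by
  refine Kernel.IsMarkovKernel.map _ ?_
  exact (m.measurable_h i).comp
    (f := fun x : (Win B M i × Win A L i × A (i : ℤ) × Win V T i) × V (i : ℤ) =>
      (x.1.1, x.1.2.1, x.1.2.2.1, x.2)) (by fun_prop)

/-- `Q_i` as a kernel from `((a^{i-1}, v^{i-1}, b^{i-1}), a_i)`. -/
def QHist (i : ℕ) : Kernel (Hist A B V i × A (i : ℤ)) (B (i : ℤ)) :=
  (m.Q i).comap (fun x => (m.bWin x.1.2.2, m.aWin x.1, x.2, m.vWin x.1)) (by fun_prop)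

instance (i : ℕ) : IsMarkovKernel (m.QHist i) := by unfold QHist; infer_instance

/-- `Q_i` as a kernel from `((a_{i-L}^{i-1}, v_{i-T}^{i-1}, b^{i-1}), a_i)`. -/
def QWin (i : ℕ) : Kernel ((Win A L i × Win V T i × Past B i) × A (i : ℤ)) (B (i : ℤ)) :=
  (m.Q i).comap (fun x => (m.bWin x.1.2.2, x.1.1, x.2, x.1.2.1)) (by fun_prop)

instance (i : ℕ) : IsMarkovKernel (m.QWin i) := by unfold QWin; infer_instance

/-- The joint law of `(a^{i-1}, v^{i-1}, b^{i-1})` given by the product, over `j < i`, of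
`Q_j(db_j | b_{j-M}^{j-1}, a_{j-L}^j, v_{j-T}^{j-1})`, `P_j(da_j | a^{j-1}, v^{j-1}, b^{j-1})` and
the point mass `dv_j` at `h̄_j(b_j, b_{j-M}^{j-1}, a_{j-L}^j)`. -/
def factorLaw (p : InputD A B V) : (i : ℕ) → Measure (Hist A B V i) :=
  trajLaw fun i => (Kernel.id ×ₖ (p.ker i ⊗ₖ m.QHist i)).map
    fun x => (x.2.1, m.hinv i x.2.2 (m.bWin x.1.2.2) (m.aWin x.1) x.2.1, x.2.2)

/-- The a posteriori distribution `P(da^{i-1}, dv^{i-1} | b^{i-1})` induced by `p`. -/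
def posteriorD (p : InputD A B V) (i : ℕ) : Kernel (Past B i) (Past A i × Past V i) :=
  condDistrib (fun x => (x.1, x.2.1)) (fun x => x.2.2) (m.law p i)

/-- The output distribution `Π_i(db_i | b^{i-1})`, the integral of
`Q_i(db_i | b_{i-M}^{i-1}, a_{i-L}^i, v_{i-T}^{i-1}) ⊗ P_i(da_i | a^{i-1}, v^{i-1}, b^{i-1})
  ⊗ P(da^{i-1}, dv^{i-1} | b^{i-1})`. -/
def outputD (p : InputD A B V) (i : ℕ) : Kernel (Past B i) (B (i : ℤ)) :=
  m.QHist i ∘ₖ (Kernel.id ×ₖ p.ker i) ∘ₖ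
    (Kernel.id ×ₖ m.posteriorD p i).map fun x => (x.2.1, x.2.2, x.1)

/-- The a posteriori distribution `P(da_{i-L}^{i-1}, dv_{i-T}^{i-1} | b^{i-1})` induced by `π`. -/
def posteriorLT (p : InputLT A B V L T) (i : ℕ) : Kernel (Past B i) (Win A L i × Win V T i) :=
  condDistrib (fun x => (m.aWin x, m.vWin x)) (fun x => x.2.2) (m.law (m.liftLT p) i)

instance (p : InputLT A B V L T) (i : ℕ) : IsMarkovKernel (m.posteriorLT p i) := by
  unfold posteriorLT; infer_instance

/-- The output distribution `Π_i(db_i | b^{i-1})`, the integral of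
`Q_i(db_i | b_{i-M}^{i-1}, a_{i-L}^i, v_{i-T}^{i-1}) ⊗ π_i(da_i | a_{i-L}^{i-1}, v_{i-T}^{i-1}, b^{i-1})
  ⊗ P(da_{i-L}^{i-1}, dv_{i-T}^{i-1} | b^{i-1})`. -/
def outputLT (p : InputLT A B V L T) (i : ℕ) : Kernel (Past B i) (B (i : ℤ)) :=
  m.QWin i ∘ₖ (Kernel.id ×ₖ p.ker i) ∘ₖ
    (Kernel.id ×ₖ m.posteriorLT p i).map fun x => (x.2.1, x.2.2, x.1)

/-- The law of `(b_i, (a_{i+1-L}^i, v_{i+1-T}^i))` when `(a_{i-L}^{i-1}, v_{i-T}^{i-1})` is drawn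
from `ξ`, `a_i` from `π_i(· | a_{i-L}^{i-1}, v_{i-T}^{i-1}, b^{i-1})`, `b_i` from `Q_i`, and
`v_i = h̄_i(b_i, b_{i-M}^{i-1}, a_{i-L}^i)`. -/
def updateJoint (p : InputLT A B V L T) (i : ℕ) (b : Past B i)
    (ξ : Measure (Win A L i × Win V T i)) :
    Measure (B (i : ℤ) × (Win A L (i + 1) × Win V T (i + 1))) :=
  (ξ ⊗ₘ (((p.ker i).comap (fun s => (s.1, s.2, b)) (by fun_prop)) ⊗ₖ
      (m.QWin i).comap (fun s => ((s.1.1, s.1.2, b), s.2)) (by fun_prop))).map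
    fun x => (x.2.2, (push x.1.1 x.2.1,
      push x.1.2 (m.hinv i x.2.2 (m.bWin b) x.1.1 x.2.1)))

instance (p : InputLT A B V L T) (i : ℕ) (b : Past B i) (ξ : Measure (Win A L i × Win V T i))
    [IsFiniteMeasure ξ] : IsFiniteMeasure (m.updateJoint p i b ξ) := by
  unfold updateJoint; infer_instance

/-- The Bayes update: the conditional distribution of `(a_{i+1-L}^i, v_{i+1-T}^i)` given `b_i = y`
under `updateJoint`. -/
def posteriorUpdate (p : InputLT A B V L T) (i : ℕ) (b : Past B i) (y : B (i : ℤ))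
    (ξ : Measure (Win A L i × Win V T i)) [IsFiniteMeasure ξ] :
    Measure (Win A L (i + 1) × Win V T (i + 1)) :=
  (m.updateJoint p i b ξ).condKernel y

/-- `E [ log ( dQ_i(· | B_{i-M}^{i-1}, A_{i-L}^i, V_{i-T}^{i-1}) / dΠ_i(· | B^{i-1}) (B_i) ) ]` under
the joint law induced by `p`. -/
def expLogD (p : InputD A B V) (i : ℕ) : ℝ≥0∞ :=
  expLogDensity (m.law p (i + 1)) (fun x => (prev x, last x.1)) (fun x => last x.2.2)
    (m.QHist i) ((m.outputD p i).comap (fun x => x.1.2.2) (by fun_prop))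

/-- `E [ log ( dQ_i(· | B_{i-M}^{i-1}, A_{i-L}^i, V_{i-T}^{i-1}) / dΠ_i(· | B^{i-1}) (B_i) ) ]` under
the joint law induced by `π`. -/
def expLogLT (p : InputLT A B V L T) (i : ℕ) : ℝ≥0∞ :=
  expLogDensity (m.law (m.liftLT p) (i + 1))
    (fun x => ((m.aWin (prev x), m.vWin (prev x), (prev x).2.2), last x.1)) (fun x => last x.2.2)
    (m.QWin i) ((m.outputLT p i).comap (fun x => x.1.2.2) (by fun_prop))

/-- The supremum of `∑_{i=0}^n E [ log (dQ_i / dΠ_i (B_i)) ]` over the input distributions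
`π_i(da_i | a_{i-L}^{i-1}, v_{i-T}^{i-1}, b^{i-1})` whose average cost up to time `n` is at most
`κ`. -/
def capLT (κ : ℝ≥0) (n : ℕ) : ℝ≥0∞ :=
  ⨆ (p : InputLT A B V L T) (_ : m.avgCost (m.law (m.liftLT p)) n ≤ κ),
    ∑ i ∈ Finset.range (n + 1), m.expLogLT p i

/-! #### Codes -/

/-- A feedback code with uniformly distributed messages and block length `n + 1`. -/
structure Code (κ : ℝ≥0) (n : ℕ) where
  /-- the number of messages -/
  K : ℕ
  K_pos : 0 < K
  enc : EncoderFB A B K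
  cost_le : m.avgCost (m.encLaw enc.toD) n ≤ κ
  dec : Past B (n + 1) → Fin K
  measurable_dec : Measurable dec

/-- The average probability of decoding error. -/
def Code.errorProb {m : Model A B V L M T} {κ : ℝ≥0} {n : ℕ} (c : m.Code κ n) : ℝ≥0∞ :=
  (∑ w : Fin c.K, m.law (c.enc.toD.toInput w) (n + 1) {x | c.dec x.2.2 ≠ w}) / c.K

/-- The coding rate `(1/(n+1)) log K`. -/
def Code.rate {m : Model A B V L M T} {κ : ℝ≥0} {n : ℕ} (c : m.Code κ n) : ℝ≥0∞ :=
  ENNReal.ofReal (Real.log c.K / (n + 1))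

/-- A sequence of codes is reliable if its error probabilities are bounded by some `ε_n → 0`. -/
def Reliable {κ : ℝ≥0} (c : (n : ℕ) → m.Code κ n) : Prop :=
  ∃ ε : ℕ → ℝ, Tendsto ε atTop (𝓝 0) ∧ ∀ n, (c n).errorProb ≤ ENNReal.ofReal (ε n)

/-- `R` is an achievable rate. -/
def Achievable (κ : ℝ≥0) (R : ℝ) : Prop :=
  ∃ c : (n : ℕ) → m.Code κ n, m.Reliable c ∧
    ENNReal.ofReal R ≤ liminf (fun n => (c n).rate) atTop

end Model

end NCMD

end

/-!
The information terms are handled through conditional laws. Given the history and `a_i`, the output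
`b_i` has law `Q_i`, which depends only on `a_{i-L}^i`, `v_{i-T}^{i-1}` and `b_{i-M}^{i-1}`
(`Model.hasCondDistrib_QHist`). Hence the measure whose relative entropy defines
`I(A_{i-L}^i, V_{i-T}^{i-1}; B_i | B^{i-1})` and its reference measure are composition products with
the same first factor, and their density is the density of `Q_i` with respect to `Π_i`
(`condMutualInfo_eq_expLogDensity`).

Inverting the channel recovers each `v_i` from `b_i`, `b_{i-M}^{i-1}` and `a_{i-L}^i`. This has
three consequences. The past noise is a function of past inputs and outputs, so an input
distribution may ignore it without changing the joint law (`Model.law_toC`). The triple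
`(a_{i+1-L}^i, v_{i+1-T}^i, b^i)` is a function of its predecessor, `a_i` and `b_i`; therefore its
law, and with it all costs and information terms, depends on the input distribution only through
the conditional law of `a_i` given `(a_{i-L}^{i-1}, v_{i-T}^{i-1}, b^{i-1})`
(`Model.map_toWin_liftLT`), and disintegrating the law of `b_i` and the next windows in two ways
gives the recursion of the a posteriori distributions (`Model.posteriorLT_succ`). Finally, in a
feedback code the whole history is a function of the message and the outputs
(`Model.ae_eq_replay`).

The last fact turns the converse into a chain rule. The conditional law of `b_i` given the message
and `b^{i-1}` is the channel law, so the chain rule for relative entropy bounds the mutual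
information between the message and `b^n` by the sum of the information terms
(`Model.klDiv_msgLaw_le`). Fano's inequality, obtained as a Donsker-Varadhan bound
(`measureReal_mul_log_le_klDiv`), compares this with the rate. Averaging an encoding strategy over
the messages gives the joint law of an input distribution (`Model.encLaw_eq_law`), so the resulting
bound is at most the supremum over input distributions.
-/

noncomputable section

namespace NCMD

/-! ### Conditional laws -/

section General

variable {Ω S T U Z W X Y : Type*} [MeasurableSpace Ω] [MeasurableSpace S] [MeasurableSpace T]
  [MeasurableSpace U] [MeasurableSpace Z] [MeasurableSpace W] [MeasurableSpace X]
  [MeasurableSpace Y]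

lemma hasCondDistrib_iff {μ : Measure Ω} {x : Ω → X} {y : Ω → Y} (hx : Measurable x)
    (hy : Measurable y) {κ : Kernel X Y} :
    HasCondDistrib y x κ μ ↔ μ.map (fun ω => (x ω, y ω)) = μ.map x ⊗ₘ κ :=
  ⟨fun h => h.map_eq, fun h => ⟨(hx.prodMk hy).aemeasurable, h⟩⟩

/-- Conditional laws, characterized by integrals of test functions. -/
lemma hasCondDistrib_iff_lintegral {μ : Measure Ω} [SFinite μ] {x : Ω → X} {y : Ω → Y}
    (hx : Measurable x) (hy : Measurable y) {κ : Kernel X Y} [IsSFiniteKernel κ] :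
    HasCondDistrib y x κ μ ↔ ∀ f : X × Y → ℝ≥0∞, Measurable f →
      ∫⁻ ω, f (x ω, y ω) ∂μ = ∫⁻ ω, ∫⁻ t, f (x ω, t) ∂κ (x ω) ∂μ := by
  rw [hasCondDistrib_iff hx hy]
  have key : ∀ f : X × Y → ℝ≥0∞, Measurable f →
      ∫⁻ p, f p ∂(μ.map x ⊗ₘ κ) = ∫⁻ ω, ∫⁻ t, f (x ω, t) ∂κ (x ω) ∂μ := fun f hf => by
    rw [Measure.lintegral_compProd hf, lintegral_map hf.lintegral_kernel_prod_right' hx]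
  refine ⟨fun h f hf => ?_, fun h => Measure.ext_of_lintegral _ fun f hf => ?_⟩
  · rw [← key f hf, ← h, lintegral_map hf (hx.prodMk hy)]
  · rw [key f hf, lintegral_map hf (hx.prodMk hy), h f hf]

lemma hasCondDistrib_of_map {μ : Measure Ω} {f : Ω → S} (hf : Measurable f) {x : S → X} {y : S → Y}
    (hx : Measurable x) (hy : Measurable y) {κ : Kernel X Y}
    (h : HasCondDistrib y x κ (μ.map f)) :
    HasCondDistrib (fun ω => y (f ω)) (fun ω => x (f ω)) κ μ := by
  refine (hasCondDistrib_iff (hx.comp hf) (hy.comp hf)).2 ?_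
  have := h.map_eq
  rwa [Measure.map_map (hx.prodMk hy) hf, Measure.map_map hx hf] at this

lemma hasCondDistrib_map {μ : Measure Ω} {f : Ω → S} (hf : Measurable f) {x : S → X} {y : S → Y}
    (hx : Measurable x) (hy : Measurable y) {κ : Kernel X Y}
    (h : HasCondDistrib (fun ω => y (f ω)) (fun ω => x (f ω)) κ μ) :
    HasCondDistrib y x κ (μ.map f) := by
  rw [hasCondDistrib_iff hx hy, Measure.map_map (hx.prodMk hy) hf, Measure.map_map hx hf]
  exact h.map_eq

lemma hasCondDistrib_condDistrib [StandardBorelSpace Y] [Nonempty Y] {μ : Measure Ω}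
    [IsFiniteMeasure μ] {x : Ω → X} {y : Ω → Y} (hx : Measurable x) (hy : Measurable y) :
    HasCondDistrib y x (condDistrib y x μ) μ :=
  (hasCondDistrib_iff hx hy).2 (compProd_map_condDistrib hy.aemeasurable).symm

/-- If `s` has conditional law `σ` given `x` and `y` has conditional law `κ` given `s`, and `x` is a
function of `s`, then `y` has conditional law `κ ∘ₖ σ` given `x`. -/
lemma hasCondDistrib_comp {μ : Measure Ω} [SFinite μ] {x : Ω → X} {s : Ω → S} {y : Ω → Y}
    (hs : Measurable s) (hy : Measurable y)
    {g : S → X} (hg : Measurable g) (hgx : ∀ ω, x ω = g (s ω))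
    {σ : Kernel X S} [IsSFiniteKernel σ] {κ : Kernel S Y} [IsSFiniteKernel κ]
    (h1 : HasCondDistrib s x σ μ) (h2 : HasCondDistrib y s κ μ) :
    HasCondDistrib y x (κ ∘ₖ σ) μ := by
  have hx : Measurable x := by
    rw [show x = g ∘ s from funext hgx]; exact hg.comp hs
  rw [hasCondDistrib_iff_lintegral hx hs] at h1
  rw [hasCondDistrib_iff_lintegral hs hy] at h2
  rw [hasCondDistrib_iff_lintegral hx hy]
  intro f hf
  have e1 := h2 (fun q => f (g q.1, q.2)) (by fun_prop)
  have e2 := h1 (fun q => ∫⁻ t, f (q.1, t) ∂κ q.2) (by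
    have : Measurable fun r : (X × S) × Y => f (r.1.1, r.2) := by fun_prop
    exact this.lintegral_kernel_prod_right' (κ := κ.comap Prod.snd measurable_snd))
  simp only [← hgx] at e1
  rw [e1, e2]
  refine lintegral_congr fun ω => ?_
  rw [Kernel.lintegral_comp _ _ _ (by fun_prop)]

lemma hasCondDistrib_id_prod {μ : Measure Ω} [SFinite μ] {x : Ω → X} {y : Ω → Y}
    (hx : Measurable x) (hy : Measurable y) {κ : Kernel X Y} [IsSFiniteKernel κ]
    (h : HasCondDistrib y x κ μ) :
    HasCondDistrib (fun ω => (x ω, y ω)) x (Kernel.id ×ₖ κ) μ := by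
  rw [hasCondDistrib_iff_lintegral hx hy] at h
  rw [hasCondDistrib_iff_lintegral hx (hx.prodMk hy)]
  intro f hf
  rw [h (fun q => f (q.1, q)) (by fun_prop)]
  refine lintegral_congr fun ω => ?_
  rw [Kernel.lintegral_id_prod (by fun_prop)]

lemma hasCondDistrib_compProd {μ : Measure Ω} [SFinite μ] {x : Ω → X} {y : Ω → Y} {z : Ω → Z}
    (hx : Measurable x) (hy : Measurable y) (hz : Measurable z) {κ : Kernel X Y}
    [IsSFiniteKernel κ] {η : Kernel (X × Y) Z} [IsSFiniteKernel η] (h1 : HasCondDistrib y x κ μ)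
    (h2 : HasCondDistrib z (fun ω => (x ω, y ω)) η μ) :
    HasCondDistrib (fun ω => (y ω, z ω)) x (κ ⊗ₖ η) μ := by
  rw [hasCondDistrib_iff_lintegral hx hy] at h1
  rw [hasCondDistrib_iff_lintegral (hx.prodMk hy) hz] at h2
  rw [hasCondDistrib_iff_lintegral hx (hy.prodMk hz)]
  intro f hf
  have hf' : Measurable fun q : (X × Y) × Z => f (q.1.1, q.1.2, q.2) := by fun_prop
  rw [h2 (fun q => f (q.1.1, q.1.2, q.2)) hf',
    h1 (fun q => ∫⁻ t, f (q.1, q.2, t) ∂η q) hf'.lintegral_kernel_prod_right']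
  refine lintegral_congr fun ω => ?_
  rw [Kernel.lintegral_compProd _ _ _ (by fun_prop)]

lemma hasCondDistrib_comap {μ : Measure Ω} [SFinite μ] {x : Ω → X} {y : Ω → Y}
    (hx : Measurable x) (hy : Measurable y) {κ : Kernel X Y} [IsSFiniteKernel κ]
    {g : S → X} (hg : Measurable g) {k : X → S} (hk : Measurable k)
    (hgk : ∀ t, g (k t) = t) (h : HasCondDistrib y x κ μ) :
    HasCondDistrib y (fun ω => k (x ω)) (κ.comap g hg) μ := by
  rw [hasCondDistrib_iff_lintegral hx hy] at h
  refine (hasCondDistrib_iff_lintegral (hk.comp hx) hy).2 ?_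
  intro f hf
  simpa only [Kernel.comap_apply, hgk, Function.comp_apply]
    using h (fun q => f (k q.1, q.2)) (by fun_prop)

/-! ### Relative entropy of composition products -/

/-- Composition products with the same first factor have the jointly measurable density of the
kernels as their Radon-Nikodym derivative. -/
lemma rnDeriv_compProd_right [MeasurableSpace.CountableOrCountablyGenerated X Y]
    {ν : Measure X} [IsFiniteMeasure ν] {κ η : Kernel X Y} [IsFiniteKernel κ] [IsFiniteKernel η]
    (h : ∀ᵐ x ∂ν, κ x ≪ η x) :
    (ν ⊗ₘ κ).rnDeriv (ν ⊗ₘ η) =ᵐ[ν ⊗ₘ κ] fun p => κ.rnDeriv η p.1 p.2 := by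
  have hm : Measurable (Function.uncurry (κ.rnDeriv η)) := Kernel.measurable_rnDeriv κ η
  have hac : ν ⊗ₘ κ ≪ ν ⊗ₘ η := Measure.AbsolutelyContinuous.compProd_right h
  have e : ν ⊗ₘ κ = (ν ⊗ₘ η).withDensity (fun p => κ.rnDeriv η p.1 p.2) := by
    rw [← Measure.compProd_withDensity hm]
    refine Measure.compProd_congr ?_
    filter_upwards [h] with x hx
    exact (Kernel.withDensity_rnDeriv_eq hx).symm
  have hd := Measure.rnDeriv_withDensity (ν ⊗ₘ η) hm
  simp only [Function.uncurry_def] at hd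
  rw [← e] at hd
  exact hac.ae_le hd

/-- The relative entropy of composition products with the same first factor is the expected
logarithm of the density between the kernels; the two conventions for the value `⊤` agree. -/
lemma klDiv_compProd_eq_expLogDensity [MeasurableSpace.CountableOrCountablyGenerated S Z]
    {μ : Measure Ω} [IsFiniteMeasure μ] {s : Ω → S} {z : Ω → Z} (hs : Measurable s)
    (hz : Measurable z) {q η : Kernel S Z} [IsMarkovKernel q] [IsMarkovKernel η]
    (h : HasCondDistrib z s q μ) :
    klDiv (μ.map s ⊗ₘ q) (μ.map s ⊗ₘ η) = expLogDensity μ s z q η := by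
  classical
  unfold expLogDensity
  by_cases hac : ∀ᵐ x ∂(μ.map s), q x ≪ η x
  swap
  · rw [if_neg (fun h => hac h.1), klDiv_of_not_ac]
    rwa [Measure.absolutelyContinuous_compProd_right_iff]
  have hac' : μ.map s ⊗ₘ q ≪ μ.map s ⊗ₘ η := Measure.AbsolutelyContinuous.compProd_right hac
  have hm : Measurable (fun p : S × Z => Real.log (q.rnDeriv η p.1 p.2).toReal) :=
    Real.measurable_log.comp (Kernel.measurable_rnDeriv q η).ennreal_toReal
  have hl : llr (μ.map s ⊗ₘ q) (μ.map s ⊗ₘ η)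
      =ᵐ[μ.map s ⊗ₘ q] fun p => Real.log (q.rnDeriv η p.1 p.2).toReal := by
    filter_upwards [rnDeriv_compProd_right hac] with p hp
    simp only [llr, hp]
  have hi : Integrable (llr (μ.map s ⊗ₘ q) (μ.map s ⊗ₘ η)) (μ.map s ⊗ₘ q) ↔
      Integrable (fun ω => Real.log (q.rnDeriv η (s ω) (z ω)).toReal) μ := by
    rw [integrable_congr hl, ← h.map_eq,
      integrable_map_measure hm.aestronglyMeasurable (hs.prodMk hz).aemeasurable]
    rfl
  by_cases hint : Integrable (fun ω => Real.log (q.rnDeriv η (s ω) (z ω)).toReal) μ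
  · rw [if_pos ⟨hac, hint⟩, klDiv_of_ac_of_integrable hac' (hi.2 hint), integral_congr_ae hl,
      measureReal_def, measureReal_def, Measure.compProd_apply_univ, Measure.compProd_apply_univ]
    rw [add_sub_cancel_right, ← h.map_eq,
      integral_map (hs.prodMk hz).aemeasurable hm.aestronglyMeasurable]
  · rw [if_neg (fun h => hint h.2), klDiv_of_not_integrable (fun h => hint (hi.1 h))]

/-- Expected log-densities may be computed after discarding the part of `s` on which the kernels do
not depend. -/
lemma expLogDensity_comap [MeasurableSpace.CountablyGenerated Z]
    {μ : Measure Ω} {s : Ω → S} {z : Ω → Z} (hs : Measurable s) (hz : Measurable z)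
    {φ : S → T} (hφ : Measurable φ) {q η : Kernel T Z} [IsMarkovKernel q]
    [IsMarkovKernel η] [IsFiniteMeasure μ] (h : HasCondDistrib z s (q.comap φ hφ) μ) :
    expLogDensity μ s z (q.comap φ hφ) (η.comap φ hφ)
      = expLogDensity μ (fun ω => φ (s ω)) z q η := by
  classical
  have h1 : (∀ᵐ x ∂(μ.map s), q.comap φ hφ x ≪ η.comap φ hφ x) ↔
      ∀ᵐ x ∂(μ.map fun ω => φ (s ω)), q x ≪ η x := by
    rw [ae_map_iff (f := fun ω => φ (s ω)) (hφ.comp hs).aemeasurable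
        (Kernel.measurableSet_absolutelyContinuous q η),
      ae_map_iff hs.aemeasurable
        (Kernel.measurableSet_absolutelyContinuous (q.comap φ hφ) (η.comap φ hφ))]
    rfl
  unfold expLogDensity
  rw [h1]
  by_cases hac : ∀ᵐ x ∂(μ.map fun ω => φ (s ω)), q x ≪ η x
  swap
  · rw [if_neg (fun h => hac h.1), if_neg (fun h => hac h.1)]
  have hac2 := h1.2 hac
  have e : ∀ᵐ ω ∂μ, Kernel.rnDeriv (q.comap φ hφ) (η.comap φ hφ) (s ω) (z ω)
      = Kernel.rnDeriv q η (φ (s ω)) (z ω) := by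
    have m1 := Kernel.measurable_rnDeriv (q.comap φ hφ) (η.comap φ hφ)
    have m2 : Measurable fun p : S × Z => Kernel.rnDeriv q η (φ p.1) p.2 :=
      (Kernel.measurable_rnDeriv q η).comp (f := fun p : S × Z => (φ p.1, p.2)) (by fun_prop)
    refine ae_of_ae_map (f := fun ω => (s ω, z ω)) (p := fun p : S × Z =>
      Kernel.rnDeriv (q.comap φ hφ) (η.comap φ hφ) p.1 p.2 = Kernel.rnDeriv q η (φ p.1) p.2)
      (hs.prodMk hz).aemeasurable ?_
    rw [h.map_eq, Measure.ae_compProd_iff (measurableSet_eq_fun m1 m2)]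
    filter_upwards [hac2] with x hx
    refine hx.ae_le ?_
    have a1 := Kernel.rnDeriv_eq_rnDeriv_measure (κ := q.comap φ hφ) (η := η.comap φ hφ) (a := x)
    have a2 := Kernel.rnDeriv_eq_rnDeriv_measure (κ := q) (η := η) (a := φ x)
    filter_upwards [a1, a2] with y h1 h2
    rw [h1, h2]; rfl
  have e' : (fun ω => Real.log (Kernel.rnDeriv (q.comap φ hφ) (η.comap φ hφ) (s ω) (z ω)).toReal)
      =ᵐ[μ] fun ω => Real.log (Kernel.rnDeriv q η (φ (s ω)) (z ω)).toReal := by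
    filter_upwards [e] with ω h
    rw [h]
  rw [integrable_congr e', integral_congr_ae e']

lemma klDiv_map_measurableEquiv (e : X ≃ᵐ Y) (μ ν : Measure X) [IsFiniteMeasure μ]
    [IsFiniteMeasure ν] : klDiv (μ.map e) (ν.map e) = klDiv μ ν := by
  refine le_antisymm (klDiv_map_le μ ν e.measurable) ?_
  have := klDiv_map_le (μ.map e) (ν.map e) e.symm.measurable
  simpa [Measure.map_map e.symm.measurable e.measurable] using this

lemma condMutualInfo_congr {Ω' : Type*} [MeasurableSpace Ω'] [StandardBorelSpace U] [Nonempty U]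
    [StandardBorelSpace Z] [Nonempty Z]
    {μ : Measure Ω} [IsFiniteMeasure μ] {μ' : Measure Ω'} [IsFiniteMeasure μ']
    {u : Ω → U} {z : Ω → Z} {w : Ω → W} {u' : Ω' → U} {z' : Ω' → Z} {w' : Ω' → W}
    (hu : Measurable u) (hz : Measurable z) (hw : Measurable w)
    (hu' : Measurable u') (hz' : Measurable z') (hw' : Measurable w')
    (h : μ.map (fun ω => (w ω, (u ω, z ω))) = μ'.map (fun ω => (w' ω, (u' ω, z' ω)))) :
    condMutualInfo μ u z w = condMutualInfo μ' u' z' w' := by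
  have h1 := congrArg (Measure.map Prod.fst) h
  have h2 := congrArg (Measure.map fun p : W × (U × Z) => (p.1, p.2.1)) h
  have h3 := congrArg (Measure.map fun p : W × (U × Z) => (p.1, p.2.2)) h
  rw [Measure.map_map (by fun_prop) (by fun_prop), Measure.map_map (by fun_prop) (by fun_prop)]
    at h1 h2 h3
  simp only [Function.comp_def] at h1 h2 h3
  unfold condMutualInfo
  simp only [condDistrib, h, h1]
  congr 3
  · simp only [h2]
  · simp only [h3]

/-- If the conditional law of `z` given `s` depends only on `φ (s) = (w, u)`, the conditional mutual
information `I(u; z | w)` is the relative entropy of that conditional law with respect to the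
conditional law of `z` given `w`, averaged over `s`. -/
lemma condMutualInfo_eq_expLogDensity [StandardBorelSpace U] [Nonempty U] [StandardBorelSpace Z]
    [Nonempty Z] {μ : Measure Ω} [IsFiniteMeasure μ] {s : Ω → S} {u : Ω → U} {z : Ω → Z} {w : Ω → W}
    (hs : Measurable s) (hz : Measurable z) (hu : Measurable u) (hw : Measurable w)
    {φ : S → W × U} (hφ : Measurable φ)
    (hφs : ∀ ω, φ (s ω) = (w ω, u ω)) {q : Kernel (W × U) Z} [IsMarkovKernel q]
    (hq : HasCondDistrib z s (q.comap φ hφ) μ) {η : Kernel W Z} [IsMarkovKernel η]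
    (hη : HasCondDistrib z w η μ) :
    condMutualInfo μ u z w
      = expLogDensity μ s z (q.comap φ hφ) (η.comap (fun t => (φ t).1) (by fun_prop)) := by
  have e : (η.comap (fun t => (φ t).1) (by fun_prop) : Kernel S Z)
      = ((η.comap Prod.fst measurable_fst : Kernel (W × U) Z)).comap φ hφ := rfl
  have ht : Measurable fun ω => (w ω, u ω) := by fun_prop
  have hq' : HasCondDistrib z (fun ω => (w ω, u ω)) q μ := by
    have := hq.comp_right
    rwa [show φ ∘ s = fun ω => (w ω, u ω) from funext hφs] at this
  rw [e, expLogDensity_comap hs hz hφ hq]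
  simp only [hφs]
  rw [← klDiv_compProd_eq_expLogDensity ht hz hq']
  have h1 : μ.map (fun ω => (w ω, (u ω, z ω)))
      = (μ.map (fun ω => (w ω, u ω)) ⊗ₘ q).map MeasurableEquiv.prodAssoc := by
    rw [← hq'.map_eq, Measure.map_map (by fun_prop) (by fun_prop)]
    rfl
  have h2 : (μ.map w) ⊗ₘ (condDistrib u w μ ×ₖ condDistrib z w μ)
      = (μ.map (fun ω => (w ω, u ω)) ⊗ₘ (η.comap Prod.fst measurable_fst)).map
        MeasurableEquiv.prodAssoc := by
    rw [← compProd_map_condDistrib hu.aemeasurable (X := w), Measure.compProd_assoc']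
    refine Measure.compProd_congr ?_
    have h3 := condDistrib_ae_eq_of_measure_eq_compProd w hz.aemeasurable hη.map_eq
    filter_upwards [h3] with x hx
    refine Measure.ext_of_lintegral _ fun f hf => ?_
    rw [Kernel.lintegral_prod _ _ _ hf, Kernel.lintegral_compProd _ _ _ hf, hx]
    rfl
  unfold condMutualInfo
  rw [h1, h2, klDiv_map_measurableEquiv]

/-- The Donsker-Varadhan bound for the function `(log K) 1_E - log 2`, a form of Fano's inequality:
if `E` has probability `1 / K` under `ν`, then `μ E * log K ≤ klDiv μ ν + log 2`. -/
lemma measureReal_mul_log_le_klDiv {μ ν : Measure X} [IsProbabilityMeasure μ]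
    [IsProbabilityMeasure ν] {E : Set X} (hE : MeasurableSet E) {K : ℝ} (hK : 1 ≤ K)
    (hν : ν.real E = K⁻¹) (h : klDiv μ ν ≠ ⊤) :
    μ.real E * Real.log K ≤ (klDiv μ ν).toReal + Real.log 2 := by
  obtain ⟨hac, hint⟩ := klDiv_ne_top_iff.1 h
  have hK0 : 0 < K := by linarith
  -- with the shift by `log 2`, the exponential of `g` has `ν`-integral `(2 - 1 / K) / 2 ≤ 1`
  set g : X → ℝ := fun x => E.indicator (fun _ => Real.log K) x - Real.log 2 with hg
  have hgi : ∀ (ρ : Measure X) [IsProbabilityMeasure ρ], Integrable g ρ := fun ρ _ =>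
    ((integrable_const _).indicator hE).sub (integrable_const _)
  have hexp : ∀ x, Real.exp (g x) = E.indicator (fun _ => (K - 1) / 2) x + 1 / 2 := by
    intro x
    by_cases hx : x ∈ E
    · simp only [hg, Set.indicator_of_mem hx, Real.exp_sub, Real.exp_log hK0,
        Real.exp_log (show (0 : ℝ) < 2 by norm_num)]; ring
    · simp only [hg, Set.indicator_of_notMem hx, Real.exp_sub, Real.exp_zero,
        Real.exp_log (show (0 : ℝ) < 2 by norm_num)]; ring
  have hei : Integrable (fun x => Real.exp (g x)) ν := by
    simp only [hexp]
    exact ((integrable_const _).indicator hE).add (integrable_const _)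
  have hexpint : ∫ x, Real.exp (g x) ∂ν ≤ 1 := by
    simp only [hexp]
    rw [integral_add ((integrable_const _).indicator hE) (integrable_const _),
      integral_indicator_const _ hE, hν]
    simp only [smul_eq_mul, integral_const, probReal_univ]
    have : K⁻¹ * K = 1 := inv_mul_cancel₀ hK0.ne'
    have h3 : 0 < K⁻¹ := by positivity
    nlinarith
  have hgμ : ∫ x, g x ∂μ = μ.real E * Real.log K - Real.log 2 := by
    rw [integral_sub ((integrable_const _).indicator hE) (integrable_const _),
      integral_indicator_const _ hE]
    simp
  -- Young's inequality for the convex function `klFun`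
  have young : ∀ r : ℝ, 0 ≤ r → ∀ y : ℝ, r * y - Real.exp y + 1 ≤ klFun r := by
    intro r hr y
    rw [klFun_apply]
    rcases hr.eq_or_lt with rfl | hr
    · have := Real.exp_pos y
      simp; linarith
    · have h1 := Real.add_one_le_exp (y - Real.log r)
      rw [Real.exp_sub, Real.exp_log hr, le_div_iff₀ hr] at h1
      linarith
  have hri : Integrable (fun x => (μ.rnDeriv ν x).toReal * g x) ν := by
    have := (integrable_rnDeriv_smul_iff hac (f := g)).2 (hgi μ)
    simpa using this
  have hkl : (klDiv μ ν).toReal = ∫ x, klFun (μ.rnDeriv ν x).toReal ∂ν :=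
    toReal_klDiv_eq_integral_klFun hac
  have hki : Integrable (fun x => klFun (μ.rnDeriv ν x).toReal) ν :=
    (integrable_klFun_rnDeriv_iff hac).2 hint
  have hle : ∫ x, ((μ.rnDeriv ν x).toReal * g x - Real.exp (g x) + 1) ∂ν
      ≤ ∫ x, klFun (μ.rnDeriv ν x).toReal ∂ν :=
    integral_mono ((hri.sub hei).add (integrable_const _)) hki
      fun x => young _ ENNReal.toReal_nonneg _
  rw [integral_add (f := fun x => (μ.rnDeriv ν x).toReal * g x - Real.exp (g x)) (hri.sub hei)
    (integrable_const _), integral_sub hri hei] at hle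
  have hsm : ∫ x, (μ.rnDeriv ν x).toReal * g x ∂ν = ∫ x, g x ∂μ := by
    have := integral_rnDeriv_smul hac (f := g)
    simpa using this
  rw [hsm, hgμ, ← hkl] at hle
  simp at hle
  linarith

end General

/-! ### Strings, windows and joint laws -/

section Strings

variable {X : ℤ → Type*} {m : ℕ}

@[simp] lemma dropLast_append {i : ℕ} (x : Past X i) (y : X (i : ℤ)) :
    dropLast (append x y) = x := by
  funext k
  exact Fin.snoc_castSucc (α := fun j : Fin (i + 1) => X ((j : ℕ) : ℤ)) _ _ _

@[simp] lemma last_append {i : ℕ} (x : Past X i) (y : X (i : ℤ)) : last (append x y) = y :=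
  Fin.snoc_last (α := fun j : Fin (i + 1) => X ((j : ℕ) : ℤ)) _ _

@[simp] lemma append_dropLast_last {i : ℕ} (x : Past X (i + 1)) :
    append (dropLast x) (last x) = x := by
  funext j
  refine Fin.lastCases ?_ (fun k => ?_) j
  · exact last_append _ _
  · exact congrFun (dropLast_append (dropLast x) (last x)) k

lemma win_append (x0 : Win X m 0) {i : ℕ} (x : Past X i) (y : X (i : ℤ)) :
    win x0 (i + 1) (append x y) = push (win x0 i x) y := by
  funext j
  match j with
  | ⟨Int.ofNat k, hk⟩ =>
    have hk2 : k < i + 1 := by have := hk.2; simp at this; omega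
    by_cases h : k < i
    · have h' : (Int.ofNat k : ℤ) < i := by simpa using h
      have e : (⟨k, hk2⟩ : Fin (i + 1)) = (⟨k, h⟩ : Fin i).castSucc := rfl
      simp only [push, h', dif_pos]
      exact congrFun (dropLast_append x y) ⟨k, h⟩
    · obtain rfl : k = i := by omega
      have h' : ¬ (Int.ofNat k : ℤ) < (k : ℤ) := by simp
      simp only [push, h', dif_neg, not_false_eq_true]
      exact last_append x y
  | ⟨Int.negSucc k, hk⟩ =>
    have h' : Int.negSucc k < (i : ℤ) := by omega
    simp only [push, h', dif_pos]
    rfl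

lemma win_zero (x0 : Win X m 0) (x : Past X 0) : win x0 0 x = x0 := by
  funext j
  match j with
  | ⟨Int.ofNat k, hk⟩ => exact absurd hk.2 (by simp)
  | ⟨Int.negSucc k, hk⟩ => rfl

variable [∀ j, MeasurableSpace (X j)]

@[fun_prop]
lemma measurable_dropLast {i : ℕ} : Measurable (dropLast : Past X (i + 1) → Past X i) :=
  measurable_pi_lambda _ fun j => measurable_pi_apply j.castSucc

@[fun_prop]
lemma measurable_last {i : ℕ} : Measurable (last : Past X (i + 1) → X (i : ℤ)) :=
  measurable_pi_apply (Fin.last i)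

@[fun_prop]
lemma Measurable.append {E : Type*} [MeasurableSpace E] {i : ℕ} {f : E → Past X i}
    {g : E → X (i : ℤ)} (hf : Measurable f) (hg : Measurable g) :
    Measurable fun e => append (f e) (g e) :=
  measurable_append.comp (hf.prodMk hg)

lemma measurable_cast_symbol {j k : ℤ} (h : j = k) : Measurable (cast (congrArg X h)) := by
  subst h; exact measurable_id

@[fun_prop]
lemma Measurable.push {E : Type*} [MeasurableSpace E] {i : ℕ} {f : E → Win X m i}
    {g : E → X (i : ℤ)} (hf : Measurable f) (hg : Measurable g) :
    Measurable fun e => push (f e) (g e) := by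
  refine measurable_pi_lambda _ fun j => ?_
  unfold NCMD.push
  split_ifs with h
  · exact (measurable_pi_apply _).comp hf
  · have hj : (i : ℤ) = j.1 := by have := j.2.2; push_cast at this; omega
    exact (measurable_cast_symbol hj).comp hg

end Strings

section Histories

variable {A B V : ℤ → Type*}

/-- From `(a^{i-1}, v^{i-1}, b^{i-1})` and `(a_i, v_i, b_i)` to `(a^i, v^i, b^i)`. -/
def snocHist {i : ℕ} (x : Hist A B V i) (s : Sym A B V i) : Hist A B V (i + 1) :=
  (append x.1 s.1, append x.2.1 s.2.1, append x.2.2 s.2.2)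

@[simp] lemma prev_snocHist {i : ℕ} (x : Hist A B V i) (s : Sym A B V i) :
    prev (snocHist x s) = x := by
  simp [prev, snocHist]

variable [∀ j, MeasurableSpace (A j)] [∀ j, MeasurableSpace (B j)] [∀ j, MeasurableSpace (V j)]

@[fun_prop]
lemma measurable_prev {i : ℕ} : Measurable (prev : Hist A B V (i + 1) → Hist A B V i) := by
  unfold prev; fun_prop

@[fun_prop]
lemma Measurable.snocHist {E : Type*} [MeasurableSpace E] {i : ℕ} {f : E → Hist A B V i}
    {g : E → Sym A B V i} (hf : Measurable f) (hg : Measurable g) :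
    Measurable fun e => snocHist (f e) (g e) := by
  unfold NCMD.snocHist; fun_prop

namespace Model

variable {L M T : ℕ} (m : Model A B V L M T)

@[fun_prop]
lemma measurable_h_comp {E : Type*} [MeasurableSpace E] {i : ℕ} {b : E → Win B M i}
    {a : E → Win A L i} {x : E → A (i : ℤ)} {v : E → V (i : ℤ)} (hb : Measurable b)
    (ha : Measurable a) (hx : Measurable x) (hv : Measurable v) :
    Measurable fun e => m.h i (b e) (a e) (x e) (v e) :=
  (m.measurable_h i).comp (hb.prodMk (ha.prodMk (hx.prodMk hv)))

@[fun_prop]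
lemma measurable_hinv_comp {E : Type*} [MeasurableSpace E] {i : ℕ} {y : E → B (i : ℤ)}
    {b : E → Win B M i} {a : E → Win A L i} {x : E → A (i : ℤ)} (hy : Measurable y)
    (hb : Measurable b) (ha : Measurable a) (hx : Measurable x) :
    Measurable fun e => m.hinv i (y e) (b e) (a e) (x e) :=
  (m.measurable_hinv i).comp (hy.prodMk (hb.prodMk (ha.prodMk hx)))

/-- The history after time `i`, from the history before time `i`, the input `a_i` and the noise
`v_i`. -/
def extend {i : ℕ} (x : Hist A B V i) (a : A (i : ℤ)) (v : V (i : ℤ)) : Hist A B V (i + 1) :=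
  snocHist x (a, v, m.h i (m.bWin x.2.2) (m.aWin x) a v)

@[fun_prop]
lemma measurable_extend {E : Type*} [MeasurableSpace E] {i : ℕ} {x : E → Hist A B V i}
    {a : E → A (i : ℤ)} {v : E → V (i : ℤ)} (hx : Measurable x) (ha : Measurable a)
    (hv : Measurable v) : Measurable fun e => m.extend (x e) (a e) (v e) := by
  unfold extend; fun_prop

/-- The noise distribution as a kernel from `((a^{i-1}, v^{i-1}, b^{i-1}), a_i)`. -/
def noiseHist (i : ℕ) : Kernel (Hist A B V i × A (i : ℤ)) (V (i : ℤ)) :=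
  (m.noise i).comap (fun x => m.vWin x.1) (by fun_prop)

instance (i : ℕ) : IsMarkovKernel (m.noiseHist i) := by unfold noiseHist; infer_instance

/-- The law of `(a^i, v^i, b^i)` when `((a^{i-1}, v^{i-1}, b^{i-1}), a_i)` has law `ρ`. -/
def emit (i : ℕ) (ρ : Measure (Hist A B V i × A (i : ℤ))) : Measure (Hist A B V (i + 1)) :=
  (ρ ⊗ₘ m.noiseHist i).map fun p => m.extend p.1.1 p.1.2 p.2

lemma lintegral_emit {i : ℕ} (ρ : Measure (Hist A B V i × A (i : ℤ))) [SFinite ρ]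
    {f : Hist A B V (i + 1) → ℝ≥0∞} (hf : Measurable f) :
    ∫⁻ x, f x ∂m.emit i ρ
      = ∫⁻ p, ∫⁻ v, f (m.extend p.1 p.2 v) ∂m.noise i (m.vWin p.1) ∂ρ := by
  unfold emit
  rw [lintegral_map hf (by fun_prop), Measure.lintegral_compProd (by fun_prop)]
  rfl

lemma lintegral_step (p : InputD A B V) (i : ℕ) (x : Hist A B V i)
    {f : Sym A B V i → ℝ≥0∞} (hf : Measurable f) :
    ∫⁻ s, f s ∂m.step p i x = ∫⁻ a, ∫⁻ v, f (a, v, m.h i (m.bWin x.2.2) (m.aWin x) a v)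
      ∂m.noise i (m.vWin x) ∂p.ker i x := by
  unfold step
  rw [Kernel.lintegral_map _ (by fun_prop) _ hf, Kernel.lintegral_id_prod (by fun_prop),
    Kernel.lintegral_prod _ _ _ (by fun_prop)]
  rfl

lemma lintegral_QHist (i : ℕ) (x : Hist A B V i × A (i : ℤ))
    {f : B (i : ℤ) → ℝ≥0∞} (hf : Measurable f) :
    ∫⁻ y, f y ∂m.QHist i x
      = ∫⁻ v, f (m.h i (m.bWin x.1.2.2) (m.aWin x.1) x.2 v) ∂m.noise i (m.vWin x.1) := by
  unfold QHist Q
  rw [Kernel.comap_apply, Kernel.lintegral_map _ (by fun_prop) _ hf,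
    Kernel.lintegral_id_prod (by fun_prop)]
  rfl

instance (p : InputD A B V) (i : ℕ) : IsMarkovKernel (m.step p i) := m.isMarkovKernel_step p i

lemma law_succ (p : InputD A B V) (i : ℕ) :
    m.law p (i + 1) = m.emit i (m.law p i ⊗ₘ p.ker i) := by
  refine Measure.ext_of_lintegral _ fun f hf => ?_
  rw [lintegral_emit _ _ hf, Measure.lintegral_compProd (by
    have : Measurable fun q : (Hist A B V i × A (i : ℤ)) × V (i : ℤ) =>
      f (m.extend q.1.1 q.1.2 q.2) := by fun_prop
    exact this.lintegral_kernel_prod_right' (κ := m.noiseHist i))]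
  change ∫⁻ x, f x ∂(((m.law p i) ⊗ₘ (m.step p i)).map fun x => snocHist x.1 x.2) = _
  rw [lintegral_map hf (by fun_prop), Measure.lintegral_compProd (by fun_prop)]
  refine lintegral_congr fun x => ?_
  rw [lintegral_step _ _ _ _ (by fun_prop)]
  rfl

/-- The empty history. -/
def emptyHist : Hist A B V 0 := (fun j => j.elim0, fun j => j.elim0, fun j => j.elim0)

lemma law_zero (p : InputD A B V) : m.law p 0 = Measure.dirac emptyHist := rfl

/-- The joint laws are determined by their recursion. -/
lemma eq_law {p : InputD A B V} {ρ : (i : ℕ) → Measure (Hist A B V i)}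
    (h0 : ρ 0 = Measure.dirac emptyHist) (hs : ∀ i, ρ (i + 1) = m.emit i (ρ i ⊗ₘ p.ker i)) (i : ℕ) :
    ρ i = m.law p i := by
  induction i with
  | zero => rw [h0, law_zero]
  | succ i ih => rw [hs, ih, law_succ]

section Emit

variable {i : ℕ} (ρ : Measure (Hist A B V i × A (i : ℤ)))

instance [IsProbabilityMeasure ρ] : IsProbabilityMeasure (m.emit i ρ) := by
  unfold emit
  exact Measure.isProbabilityMeasure_map (Measurable.aemeasurable (by fun_prop))

lemma map_emit [SFinite ρ] : (m.emit i ρ).map (fun x => (prev x, last x.1)) = ρ := by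
  refine Measure.ext_of_lintegral _ fun f hf => ?_
  rw [lintegral_map hf (by fun_prop), lintegral_emit _ _ (by fun_prop)]
  simp [extend, snocHist, prev]

lemma hasCondDistrib_emit [IsFiniteMeasure ρ] :
    HasCondDistrib (fun x => last x.2.2) (fun x => (prev x, last x.1)) (m.QHist i)
      (m.emit i ρ) := by
  have : IsFiniteMeasure (m.emit i ρ) := by unfold emit; infer_instance
  rw [hasCondDistrib_iff_lintegral (by fun_prop) (by fun_prop)]
  intro f hf
  rw [lintegral_emit _ _ (by fun_prop), lintegral_emit _ _ (by
    have : Measurable fun q : (Hist A B V i × A (i : ℤ)) × B (i : ℤ) => f q := by fun_prop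
    exact (this.lintegral_kernel_prod_right' (κ := m.QHist i)).comp
      (f := fun x : Hist A B V (i + 1) => (prev x, last x.1)) (by fun_prop))]
  refine lintegral_congr fun q => ?_
  simp only [extend, prev_snocHist]
  simp only [snocHist, last_append]
  rw [MeasureTheory.lintegral_const, measure_univ, mul_one, lintegral_QHist _ _ _ (by fun_prop)]

lemma ae_emit [SFinite ρ] {P : Hist A B V (i + 1) → Prop} (hP : MeasurableSet {x | P x})
    (h : ∀ x a v, P (m.extend x a v)) : ∀ᵐ x ∂m.emit i ρ, P x := by
  unfold emit
  rw [ae_map_iff (Measurable.aemeasurable (by fun_prop)) hP]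
  exact ae_of_all _ fun q => h _ _ _

end Emit

end Model

end Histories

namespace Model

/-! ### Channel distributions, output distributions and information terms -/

section Factorization

variable {A B V : ℤ → Type*} [∀ j, MeasurableSpace (A j)] [∀ j, MeasurableSpace (B j)]
  [∀ j, MeasurableSpace (V j)] {L M T : ℕ} (m : Model A B V L M T)

/-- The one-step kernels agree: `v_i ↦ b_i` pushes the noise distribution to `Q_i`, and the channel
inverse recovers `v_i` from `b_i`. -/
lemma law_eq_factorLaw (p : InputD A B V) (i : ℕ) : m.law p i = m.factorLaw p i := by
  unfold law factorLaw
  congr 1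
  funext j
  ext x : 1
  refine Measure.ext_of_lintegral _ fun f hf => ?_
  rw [lintegral_step _ _ _ _ hf, Kernel.lintegral_map _ (by fun_prop) _ hf,
    Kernel.lintegral_id_prod (by fun_prop), Kernel.lintegral_compProd _ _ _ (by fun_prop)]
  refine lintegral_congr fun a => ?_
  rw [lintegral_QHist _ _ _ (by fun_prop)]
  simp only [m.hinv_h]

lemma map_prev_law (p : InputD A B V) (i : ℕ) : (m.law p (i + 1)).map prev = m.law p i := by
  have h := congrArg (Measure.map Prod.fst) (m.map_emit (m.law p i ⊗ₘ p.ker i))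
  rw [← law_succ, Measure.map_map (by fun_prop) (by fun_prop)] at h
  exact h.trans (Measure.fst_compProd _ _)

lemma hasCondDistrib_input (p : InputD A B V) (i : ℕ) :
    HasCondDistrib (fun x => last x.1) prev (p.ker i) (m.law p (i + 1)) := by
  rw [hasCondDistrib_iff (by fun_prop) (by fun_prop), map_prev_law, law_succ]
  exact m.map_emit _

lemma hasCondDistrib_QHist (p : InputD A B V) (i : ℕ) :
    HasCondDistrib (fun x => last x.2.2) (fun x => (prev x, last x.1)) (m.QHist i)
      (m.law p (i + 1)) := by
  rw [law_succ]
  exact m.hasCondDistrib_emit _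

/-- From `((a^{i-1}, v^{i-1}, b^{i-1}), a_i)` to
`((a_{i-L}^{i-1}, v_{i-T}^{i-1}, b^{i-1}), a_i)`. -/
def toWin {i : ℕ} (x : Hist A B V i × A (i : ℤ)) :
    (Win A L i × Win V T i × Past B i) × A (i : ℤ) :=
  ((m.aWin x.1, m.vWin x.1, x.1.2.2), x.2)

@[fun_prop]
lemma measurable_toWin {i : ℕ} : Measurable (m.toWin (i := i)) := by unfold toWin; fun_prop

lemma hasCondDistrib_QWin_emit {i : ℕ} (ρ : Measure (Hist A B V i × A (i : ℤ)))
    [IsFiniteMeasure ρ] :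
    HasCondDistrib (fun x => last x.2.2) (fun x => m.toWin (prev x, last x.1)) (m.QWin i)
      (m.emit i ρ) := by
  have : IsFiniteMeasure (m.emit i ρ) := by unfold emit; infer_instance
  exact HasCondDistrib.comp_right (f := m.toWin) (hf := m.measurable_toWin)
    (κ := m.QWin i) (m.hasCondDistrib_emit ρ)

lemma hasCondDistrib_QWin (p : InputD A B V) (i : ℕ) :
    HasCondDistrib (fun x => last x.2.2) (fun x => m.toWin (prev x, last x.1)) (m.QWin i)
      (m.law p (i + 1)) := by
  rw [law_succ]
  exact m.hasCondDistrib_QWin_emit _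

lemma hasCondDistrib_inputLT (π : InputLT A B V L T) (i : ℕ) :
    HasCondDistrib (fun x => last x.1)
      (fun x => (m.aWin (prev x), m.vWin (prev x), (prev x).2.2)) (π.ker i)
      (m.law (m.liftLT π) (i + 1)) :=
  HasCondDistrib.comp_right (f := fun x : Hist A B V i => (m.aWin x, m.vWin x, x.2.2))
    (hf := by fun_prop) (κ := π.ker i) (m.hasCondDistrib_input (m.liftLT π) i)

/-- `Q_i` as a kernel from `(b^{i-1}, ((a_{i-L}^{i-1}, a_i), v_{i-T}^{i-1}))`. -/
def QInfo (i : ℕ) : Kernel (Past B i × ((Win A L i × A (i : ℤ)) × Win V T i)) (B (i : ℤ)) :=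
  (m.Q i).comap (fun x => (m.bWin x.1, x.2.1.1, x.2.1.2, x.2.2)) (by fun_prop)

instance (i : ℕ) : IsMarkovKernel (m.QInfo i) := by unfold QInfo; infer_instance

end Factorization

section Information

variable {A B V : ℤ → Type*} [∀ j, MeasurableSpace (A j)] [∀ j, MeasurableSpace (B j)]
  [∀ j, MeasurableSpace (V j)] {L M T : ℕ} (m : Model A B V L M T)
  [∀ j, StandardBorelSpace (A j)] [∀ j, StandardBorelSpace (V j)] [∀ j, Nonempty (A j)]
  [∀ j, Nonempty (V j)]

instance (p : InputD A B V) (i : ℕ) : IsMarkovKernel (m.posteriorD p i) := by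
  unfold posteriorD; infer_instance

instance (p : InputD A B V) (i : ℕ) : IsMarkovKernel (m.outputD p i) := by
  have := Kernel.IsMarkovKernel.map (Kernel.id ×ₖ m.posteriorD p i)
    (f := fun x : Past B i × Past A i × Past V i => (x.2.1, x.2.2, x.1)) (by fun_prop)
  unfold outputD; infer_instance

instance (π : InputLT A B V L T) (i : ℕ) : IsMarkovKernel (m.outputLT π i) := by
  have := Kernel.IsMarkovKernel.map (Kernel.id ×ₖ m.posteriorLT π i)
    (f := fun x : Past B i × Win A L i × Win V T i => (x.2.1, x.2.2, x.1)) (by fun_prop)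
  unfold outputLT; infer_instance

lemma hasCondDistrib_outputD (p : InputD A B V) (i : ℕ) :
    HasCondDistrib (fun x => last x.2.2) (fun x => (prev x).2.2) (m.outputD p i)
      (m.law p (i + 1)) := by
  have := Kernel.IsMarkovKernel.map (Kernel.id ×ₖ m.posteriorD p i)
    (f := fun x : Past B i × Past A i × Past V i => (x.2.1, x.2.2, x.1)) (by fun_prop)
  have h0 : HasCondDistrib (fun x : Hist A B V i => (x.1, x.2.1)) (fun x => x.2.2)
      (m.posteriorD p i) (m.law p i) := hasCondDistrib_condDistrib (by fun_prop) (by fun_prop)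
  rw [← map_prev_law] at h0
  have h1 := hasCondDistrib_id_prod (by fun_prop) (by fun_prop)
    (hasCondDistrib_of_map measurable_prev (by fun_prop) (by fun_prop) h0)
  have h2 := h1.comp_left (f := fun x : Past B i × Past A i × Past V i => (x.2.1, x.2.2, x.1))
    (by fun_prop)
  have h3 := hasCondDistrib_id_prod (by fun_prop) (by fun_prop) (m.hasCondDistrib_input p i)
  have h4 := hasCondDistrib_comp (by fun_prop) (by fun_prop)
    (g := fun x : Hist A B V i => x.2.2) (by fun_prop) (fun _ => rfl) h2 h3
  have h5 := hasCondDistrib_comp (by fun_prop) (by fun_prop)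
    (g := fun x : Hist A B V i × A (i : ℤ) => x.1.2.2) (by fun_prop) (fun _ => rfl) h4
    (m.hasCondDistrib_QHist p i)
  rwa [← Kernel.comp_assoc] at h5

lemma hasCondDistrib_outputLT (π : InputLT A B V L T) (i : ℕ) :
    HasCondDistrib (fun x => last x.2.2) (fun x => (prev x).2.2) (m.outputLT π i)
      (m.law (m.liftLT π) (i + 1)) := by
  have := Kernel.IsMarkovKernel.map (Kernel.id ×ₖ m.posteriorLT π i)
    (f := fun x : Past B i × Win A L i × Win V T i => (x.2.1, x.2.2, x.1)) (by fun_prop)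
  have h0 : HasCondDistrib (fun x : Hist A B V i => (m.aWin x, m.vWin x)) (fun x => x.2.2)
      (m.posteriorLT π i) (m.law (m.liftLT π) i) :=
    hasCondDistrib_condDistrib (by fun_prop) (by fun_prop)
  rw [← map_prev_law] at h0
  have h1 := hasCondDistrib_id_prod (by fun_prop) (by fun_prop)
    (hasCondDistrib_of_map measurable_prev (by fun_prop) (by fun_prop) h0)
  have h2 := h1.comp_left (f := fun x : Past B i × Win A L i × Win V T i => (x.2.1, x.2.2, x.1))
    (by fun_prop)
  have h3 := hasCondDistrib_id_prod (by fun_prop) (by fun_prop) (m.hasCondDistrib_inputLT π i)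
  have h4 := hasCondDistrib_comp (by fun_prop) (by fun_prop)
    (g := fun x : Win A L i × Win V T i × Past B i => x.2.2) (by fun_prop) (fun _ => rfl) h2 h3
  have h5 := hasCondDistrib_comp (by fun_prop) (by fun_prop)
    (g := fun x : (Win A L i × Win V T i × Past B i) × A (i : ℤ) => x.1.2.2) (by fun_prop)
    (fun _ => rfl) h4 (m.hasCondDistrib_QWin (m.liftLT π) i)
  rwa [← Kernel.comp_assoc] at h5

variable [∀ j, StandardBorelSpace (B j)] [∀ j, Nonempty (B j)]

lemma info_eq_expLogD (p : InputD A B V) (i : ℕ) : m.info (m.law p) i = m.expLogD p i :=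
  condMutualInfo_eq_expLogDensity (s := fun x : Hist A B V (i + 1) => (prev x, last x.1))
    (φ := fun x : Hist A B V i × A (i : ℤ) => (x.1.2.2, ((m.aWin x.1, x.2), m.vWin x.1)))
    (q := m.QInfo i) (by fun_prop) (by fun_prop) (by fun_prop) (by fun_prop) (by fun_prop)
    (fun _ => rfl) (m.hasCondDistrib_QHist p i) (m.hasCondDistrib_outputD p i)

lemma info_eq_expLogLT (π : InputLT A B V L T) (i : ℕ) :
    m.info (m.law (m.liftLT π)) i = m.expLogLT π i :=
  condMutualInfo_eq_expLogDensity
    (s := fun x : Hist A B V (i + 1) => m.toWin (prev x, last x.1))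
    (φ := fun x : (Win A L i × Win V T i × Past B i) × A (i : ℤ) =>
      (x.1.2.2, ((x.1.1, x.2), x.1.2.1)))
    (q := m.QInfo i) (by fun_prop) (by fun_prop) (by fun_prop) (by fun_prop) (by fun_prop)
    (fun _ => rfl) (m.hasCondDistrib_QWin (m.liftLT π) i) (m.hasCondDistrib_outputLT π i)

/-- The information term `I(A_{i-L}^i, V_{i-T}^{i-1}; B_i | B^{i-1})` is determined by the joint law
of `a_{i-L}^{i-1}`, `v_{i-T}^{i-1}`, `b^{i-1}`, `a_i` and `b_i`. -/
lemma info_congr {ρ ρ' : (i : ℕ) → Measure (Hist A B V i)} [∀ i, IsFiniteMeasure (ρ i)]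
    [∀ i, IsFiniteMeasure (ρ' i)] {i : ℕ}
    (h : (ρ (i + 1)).map (fun x => (m.toWin (prev x, last x.1), last x.2.2))
      = (ρ' (i + 1)).map (fun x => (m.toWin (prev x, last x.1), last x.2.2))) :
    m.info ρ i = m.info ρ' i := by
  refine condMutualInfo_congr (by fun_prop) (by fun_prop) (by fun_prop) (by fun_prop)
    (by fun_prop) (by fun_prop) ?_
  have h1 := congrArg (Measure.map fun y :
    ((Win A L i × Win V T i × Past B i) × A (i : ℤ)) × B (i : ℤ) =>
      (y.1.1.2.2, (((y.1.1.1, y.1.2), y.1.1.2.1), y.2))) h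
  rwa [Measure.map_map (by fun_prop) (by fun_prop), Measure.map_map (by fun_prop) (by fun_prop)]
    at h1

end Information

section Cost

variable {A B V : ℤ → Type*} [∀ j, MeasurableSpace (A j)] [∀ j, MeasurableSpace (B j)]
  [∀ j, MeasurableSpace (V j)] {L M T : ℕ} (m : Model A B V L M T)

lemma avgCost_congr {ρ ρ' : (i : ℕ) → Measure (Hist A B V i)} {n : ℕ}
    (h : ∀ i, (ρ (i + 1)).map (fun x => (m.toWin (prev x, last x.1), last x.2.2))
      = (ρ' (i + 1)).map (fun x => (m.toWin (prev x, last x.1), last x.2.2))) :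
    m.avgCost ρ n = m.avgCost ρ' n := by
  unfold avgCost
  congr 1
  refine Finset.sum_congr rfl fun i _ => ?_
  let c : ((Win A L i × Win V T i × Past B i) × A (i : ℤ)) × B (i : ℤ) → ℝ≥0∞ := fun y =>
    m.γ i y.1.1.1 y.1.2 (m.bWin y.1.1.2.2) y.2
  have hc : Measurable c := ((m.measurable_γ i).comp
    (f := fun y : ((Win A L i × Win V T i × Past B i) × A (i : ℤ)) × B (i : ℤ) =>
      (y.1.1.1, y.1.2, m.bWin y.1.1.2.2, y.2)) (by fun_prop)).coe_nnreal_ennreal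
  have h1 := congrArg (fun μ => ∫⁻ y, c y ∂μ) (h i)
  rwa [lintegral_map hc (by fun_prop), lintegral_map hc (by fun_prop)] at h1

end Cost

/-! ### Redundancy of the past noise -/

section NoiseRecovery

variable {A B V : ℤ → Type*} [∀ j, MeasurableSpace (A j)] [∀ j, MeasurableSpace (B j)]
  [∀ j, MeasurableSpace (V j)] {L M T : ℕ} (m : Model A B V L M T)

/-- The noise `v^{i-1}` recovered from the inputs `a^{i-1}` and the outputs `b^{i-1}`, by inverting
the channel at each time. -/
def recoverNoise : (i : ℕ) → Past A i → Past B i → Past V i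
  | 0, _, _ => fun j => j.elim0
  | i + 1, a, b => append (recoverNoise i (dropLast a) (dropLast b))
      (m.hinv i (last b) (m.bWin (dropLast b)) (win m.a0 i (dropLast a)) (last a))

@[fun_prop]
lemma measurable_recoverNoise (i : ℕ) :
    Measurable fun x : Past A i × Past B i => m.recoverNoise i x.1 x.2 := by
  induction i with
  | zero => exact measurable_const
  | succ i ih =>
    have h1 : Measurable fun x : Past A (i + 1) × Past B (i + 1) =>
        m.recoverNoise i (dropLast x.1) (dropLast x.2) :=
      ih.comp (f := fun x : Past A (i + 1) × Past B (i + 1) => (dropLast x.1, dropLast x.2))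
        (by fun_prop)
    simp only [recoverNoise]
    fun_prop

/-- The feedback input distribution that evaluates `p` at the recovered noise. -/
def toC (p : InputD A B V) : InputC A B where
  ker i := (p.ker i).comap (fun x => (x.1, m.recoverNoise i x.1 x.2, x.2)) (by fun_prop)
  markov _ := inferInstance

variable [∀ j, StandardBorelSpace (V j)]

lemma ae_eq_recoverNoise (p : InputD A B V) (i : ℕ) :
    ∀ᵐ x ∂m.law p i, x.2.1 = m.recoverNoise i x.1 x.2.2 := by
  have hm : ∀ j, Measurable fun x : Hist A B V j => m.recoverNoise j x.1 x.2.2 := fun j =>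
    (m.measurable_recoverNoise j).comp (f := fun x : Hist A B V j => (x.1, x.2.2)) (by fun_prop)
  induction i with
  | zero => exact ae_of_all _ fun x => funext fun j => j.elim0
  | succ i ih =>
    rw [law_succ]
    unfold emit
    rw [ae_map_iff (Measurable.aemeasurable (by fun_prop))
      (measurableSet_eq_fun (by fun_prop) (hm _))]
    have hi : Measurable fun x : Hist A B V i × A (i : ℤ) => m.recoverNoise i x.1.1 x.1.2.2 :=
      (hm i).comp measurable_fst
    have h1 : ∀ᵐ x ∂(m.law p i ⊗ₘ p.ker i), x.1.2.1 = m.recoverNoise i x.1.1 x.1.2.2 :=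
      Measure.ae_compProd_of_ae_fst _ (measurableSet_eq_fun (by fun_prop) (hm i)) ih
    have h2 : ∀ᵐ x ∂(m.law p i ⊗ₘ p.ker i ⊗ₘ m.noiseHist i),
        x.1.1.2.1 = m.recoverNoise i x.1.1.1 x.1.1.2.2 :=
      Measure.ae_compProd_of_ae_fst (p := fun y : Hist A B V i × A (i : ℤ) =>
        y.1.2.1 = m.recoverNoise i y.1.1 y.1.2.2) _ (measurableSet_eq_fun (by fun_prop) hi) h1
    filter_upwards [h2] with x hx
    simp only [extend, snocHist, recoverNoise, dropLast_append, last_append, ← hx]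
    congr 1
    exact (m.hinv_h i _ _ _ _).symm

/-- Evaluating an input distribution at the recovered noise does not change the joint laws, since
the noise is almost surely recovered. -/
lemma law_toC (p : InputD A B V) (i : ℕ) : m.law (m.toC p).toD i = m.law p i := by
  refine (eq_law m (m.law_zero p) (fun i => ?_) i).symm
  rw [law_succ]
  congr 1
  refine Measure.compProd_congr ?_
  filter_upwards [m.ae_eq_recoverNoise p i] with x hx
  change p.ker i x = p.ker i (x.1, m.recoverNoise i x.1 x.2.2, x.2.2)
  rw [← hx]

end NoiseRecovery

section Redundancy

variable {A B V : ℤ → Type*} [∀ j, MeasurableSpace (A j)] [∀ j, MeasurableSpace (B j)]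
  [∀ j, MeasurableSpace (V j)] {L M T : ℕ} (m : Model A B V L M T)
  [∀ j, StandardBorelSpace (A j)] [∀ j, StandardBorelSpace (B j)]
  [∀ j, StandardBorelSpace (V j)] [∀ j, Nonempty (A j)] [∀ j, Nonempty (B j)]
  [∀ j, Nonempty (V j)]

lemma capD_eq_capC (κ : ℝ≥0) (n : ℕ) : m.capD κ n = m.capC κ n := by
  refine le_antisymm (iSup₂_le fun p hp => ?_) (iSup₂_le fun p hp => ?_)
  · have e : m.law (m.toC p).toD = m.law p := funext fun i => m.law_toC p i
    refine le_trans (le_of_eq ?_) (le_iSup₂_of_le (m.toC p) (by rw [e]; exact hp) le_rfl)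
    simp only [sumInfo, info, e]
  · exact le_iSup₂_of_le (f := fun (p : InputD A B V) (_ : m.avgCost (m.law p) n ≤ κ) =>
      m.sumInfo (m.law p) n) p.toD hp le_rfl

end Redundancy

/-! ### Reduction to windows of inputs and noise -/

section Windows

variable {A B V : ℤ → Type*} [∀ j, MeasurableSpace (A j)] [∀ j, MeasurableSpace (B j)]
  [∀ j, MeasurableSpace (V j)] {L M T : ℕ} (m : Model A B V L M T)

section
variable [∀ j, StandardBorelSpace (A j)] [∀ j, Nonempty (A j)]

/-- The input distributions `P(da_i | a_{i-L}^{i-1}, v_{i-T}^{i-1}, b^{i-1})` induced by `p`. -/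
def toLT (p : InputD A B V) : InputLT A B V L T where
  ker i := condDistrib (fun x => last x.1)
    (fun x => (m.aWin (prev x), m.vWin (prev x), (prev x).2.2)) (m.law p (i + 1))
  markov _ := inferInstance

lemma hasCondDistrib_toLT (p : InputD A B V) (i : ℕ) :
    HasCondDistrib (fun x => last x.1)
      (fun x => (m.aWin (prev x), m.vWin (prev x), (prev x).2.2)) ((m.toLT p).ker i)
      (m.law p (i + 1)) :=
  hasCondDistrib_condDistrib (by fun_prop) (by fun_prop)

end

/-- From `((a_{i-L}^{i-1}, v_{i-T}^{i-1}, b^{i-1}), a_i)` and `b_i` to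
`(a_{i+1-L}^i, v_{i+1-T}^i, b^i)`, where `v_i` is obtained by inverting the channel. -/
def nextWin {i : ℕ} (y : ((Win A L i × Win V T i × Past B i) × A (i : ℤ)) × B (i : ℤ)) :
    Win A L (i + 1) × Win V T (i + 1) × Past B (i + 1) :=
  (push y.1.1.1 y.1.2, push y.1.1.2.1 (m.hinv i y.2 (m.bWin y.1.1.2.2) y.1.1.1 y.1.2),
    append y.1.1.2.2 y.2)

@[fun_prop]
lemma measurable_nextWin {i : ℕ} : Measurable (m.nextWin (i := i)) := by unfold nextWin; fun_prop

/-- The joint law of `a_{i-L}^{i-1}`, `v_{i-T}^{i-1}`, `b^{i-1}`, `a_i`, `b_i` depends on the input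
distribution only through the conditional law of `a_i` given
`(a_{i-L}^{i-1}, v_{i-T}^{i-1}, b^{i-1})`. -/
lemma map_toWin_law {p : InputD A B V} {π : InputLT A B V L T} {i : ℕ}
    (h : HasCondDistrib (fun x => last x.1)
      (fun x => (m.aWin (prev x), m.vWin (prev x), (prev x).2.2)) (π.ker i) (m.law p (i + 1))) :
    (m.law p (i + 1)).map (fun x => (m.toWin (prev x, last x.1), last x.2.2))
      = ((m.law p i).map (fun x => (m.aWin x, m.vWin x, x.2.2)) ⊗ₘ π.ker i) ⊗ₘ m.QWin i := by
  rw [(m.hasCondDistrib_QWin p i).map_eq, ← m.map_prev_law p i,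
    Measure.map_map (by fun_prop) (by fun_prop)]
  congr 1
  exact h.map_eq

variable [∀ j, StandardBorelSpace (A j)] [∀ j, StandardBorelSpace (B j)]
  [∀ j, StandardBorelSpace (V j)]

/-- Inverting the channel makes the next windows a function of the current ones, `a_i` and `b_i`. -/
lemma ae_nextWin (p : InputD A B V) (i : ℕ) :
    (fun x => (m.aWin x, m.vWin x, x.2.2)) =ᵐ[m.law p (i + 1)]
      fun x => m.nextWin (m.toWin (prev x, last x.1), last x.2.2) := by
  rw [law_succ]
  refine m.ae_emit _ (measurableSet_eq_fun (by fun_prop) (by fun_prop)) fun x a v => ?_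
  simp only [extend, nextWin, toWin, prev_snocHist]
  simp only [snocHist, last_append, aWin, vWin, win_append, hinv_h]

lemma map_win_succ (p : InputD A B V) (i : ℕ) :
    (m.law p (i + 1)).map (fun x => (m.aWin x, m.vWin x, x.2.2))
      = ((m.law p (i + 1)).map
          (fun x => (m.toWin (prev x, last x.1), last x.2.2))).map m.nextWin := by
  rw [Measure.map_congr (m.ae_nextWin p i), Measure.map_map (by fun_prop) (by fun_prop)]
  rfl

/-- An input distribution and its conditional law given `(a_{i-L}^{i-1}, v_{i-T}^{i-1}, b^{i-1})`
induce the same joint law of `a_{i-L}^{i-1}`, `v_{i-T}^{i-1}`, `b^{i-1}`. -/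
lemma map_win_liftLT {p : InputD A B V} {π : InputLT A B V L T}
    (h : ∀ i, HasCondDistrib (fun x => last x.1)
      (fun x => (m.aWin (prev x), m.vWin (prev x), (prev x).2.2)) (π.ker i) (m.law p (i + 1)))
    (i : ℕ) :
    (m.law (m.liftLT π) i).map (fun x => (m.aWin x, m.vWin x, x.2.2))
      = (m.law p i).map (fun x => (m.aWin x, m.vWin x, x.2.2)) := by
  induction i with
  | zero => rw [law_zero, law_zero]
  | succ i ih =>
    rw [map_win_succ, map_win_succ, m.map_toWin_law (h i),
      m.map_toWin_law (m.hasCondDistrib_inputLT π i), ih]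

lemma map_toWin_liftLT {p : InputD A B V} {π : InputLT A B V L T}
    (h : ∀ i, HasCondDistrib (fun x => last x.1)
      (fun x => (m.aWin (prev x), m.vWin (prev x), (prev x).2.2)) (π.ker i) (m.law p (i + 1)))
    (i : ℕ) :
    (m.law (m.liftLT π) (i + 1)).map (fun x => (m.toWin (prev x, last x.1), last x.2.2))
      = (m.law p (i + 1)).map (fun x => (m.toWin (prev x, last x.1), last x.2.2)) := by
  rw [m.map_toWin_law (h i), m.map_toWin_law (m.hasCondDistrib_inputLT π i), m.map_win_liftLT h]

variable [∀ j, Nonempty (A j)]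

lemma avgCost_toLT (p : InputD A B V) (n : ℕ) :
    m.avgCost (m.law (m.liftLT (m.toLT p))) n = m.avgCost (m.law p) n :=
  m.avgCost_congr (m.map_toWin_liftLT (m.hasCondDistrib_toLT p))

variable [∀ j, Nonempty (B j)] [∀ j, Nonempty (V j)]

lemma sumInfo_toLT (p : InputD A B V) (n : ℕ) :
    m.sumInfo (m.law (m.liftLT (m.toLT p))) n = m.sumInfo (m.law p) n :=
  Finset.sum_congr rfl fun i _ =>
    m.info_congr (m.map_toWin_liftLT (m.hasCondDistrib_toLT p) i)

lemma isOptimal_toLT {κ : ℝ≥0} {n : ℕ} {p : InputD A B V} (hp : m.IsOptimal κ n p) :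
    m.IsOptimal κ n (m.liftLT (m.toLT p)) :=
  ⟨by rw [avgCost_toLT]; exact hp.1, by rw [sumInfo_toLT]; exact hp.2⟩

lemma capD_eq_capLT (κ : ℝ≥0) (n : ℕ) : m.capD κ n = m.capLT κ n := by
  have e : ∀ π : InputLT A B V L T,
      ∑ i ∈ Finset.range (n + 1), m.expLogLT π i = m.sumInfo (m.law (m.liftLT π)) n := fun π =>
    Finset.sum_congr rfl fun i _ => (m.info_eq_expLogLT π i).symm
  unfold capLT
  simp only [e]
  refine le_antisymm (iSup₂_le fun p hp => ?_) (iSup₂_le fun π hπ => ?_)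
  · exact le_iSup₂_of_le (m.toLT p) (by rw [avgCost_toLT]; exact hp) (m.sumInfo_toLT p n).ge
  · exact le_iSup₂_of_le (f := fun (p : InputD A B V) (_ : m.avgCost (m.law p) n ≤ κ) =>
      m.sumInfo (m.law p) n) (m.liftLT π) hπ le_rfl

end Windows

/-! ### Recursion of the a posteriori distributions -/

section Posterior

variable {A B V : ℤ → Type*} [∀ j, MeasurableSpace (A j)] [∀ j, MeasurableSpace (B j)]
  [∀ j, MeasurableSpace (V j)] {L M T : ℕ} (m : Model A B V L M T)
  [∀ j, StandardBorelSpace (A j)] [∀ j, StandardBorelSpace (V j)] [∀ j, Nonempty (A j)]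
  [∀ j, Nonempty (V j)]

lemma hasCondDistrib_posteriorLT (π : InputLT A B V L T) (i : ℕ) :
    HasCondDistrib (fun x => (m.aWin x, m.vWin x)) (fun x => x.2.2) (m.posteriorLT π i)
      (m.law (m.liftLT π) i) :=
  hasCondDistrib_condDistrib (by fun_prop) (by fun_prop)

lemma posteriorLT_zero (π : InputLT A B V L T) :
    m.posteriorLT π 0 = Kernel.const _ (Measure.dirac (m.a0, m.v0)) := by
  have h : HasCondDistrib (fun x => (m.aWin x, m.vWin x)) (fun x => x.2.2)
      (Kernel.const (Past B 0) (Measure.dirac (m.a0, m.v0))) (m.law (m.liftLT π) 0) := by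
    rw [hasCondDistrib_iff_lintegral (by fun_prop) (by fun_prop)]
    intro f hf
    refine lintegral_congr fun x => ?_
    rw [Kernel.const_apply, lintegral_dirac' _ (by fun_prop), aWin, vWin, win_zero, win_zero]
  have h1 := condDistrib_ae_eq_of_measure_eq_compProd (fun x : Hist A B V 0 => x.2.2)
    (by fun_prop) h.map_eq
  have : IsProbabilityMeasure ((m.law (m.liftLT π) 0).map fun x : Hist A B V 0 => x.2.2) :=
    Measure.isProbabilityMeasure_map (by fun_prop)
  obtain ⟨b, hb⟩ := h1.exists
  ext b' : 1
  rw [Subsingleton.elim b' b]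
  exact hb

/-- The law of `(b_i, (a_{i+1-L}^i, v_{i+1-T}^i))` given `b^{i-1}`, obtained by drawing
`(a_{i-L}^{i-1}, v_{i-T}^{i-1})`, `a_i` and `b_i` one after the other. -/
def updateKernel (π : InputLT A B V L T) (i : ℕ) :
    Kernel (Past B i) (B (i : ℤ) × (Win A L (i + 1) × Win V T (i + 1))) :=
  ((Kernel.id ×ₖ m.QWin i) ∘ₖ ((Kernel.id ×ₖ π.ker i) ∘ₖ
    (Kernel.id ×ₖ m.posteriorLT π i).map fun x => (x.2.1, x.2.2, x.1))).map
      fun y => (y.2, ((m.nextWin y).1, (m.nextWin y).2.1))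

lemma updateKernel_apply (π : InputLT A B V L T) (i : ℕ) (b : Past B i) :
    m.updateKernel π i b = m.updateJoint π i b (m.posteriorLT π i b) := by
  refine Measure.ext_of_lintegral _ fun f hf => ?_
  have hf1 : Measurable fun y : ((Win A L i × Win V T i × Past B i) × A (i : ℤ)) × B (i : ℤ) =>
    f (y.2, ((m.nextWin y).1, (m.nextWin y).2.1)) := by fun_prop
  have hf2 : Measurable fun x : (Win A L i × Win V T i) × A (i : ℤ) × B (i : ℤ) =>
    f (x.2.2, (push x.1.1 x.2.1, push x.1.2 (m.hinv i x.2.2 (m.bWin b) x.1.1 x.2.1))) := by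
    fun_prop
  have hf3 := (hf1.lintegral_kernel (κ := Kernel.id ×ₖ m.QWin i)).lintegral_kernel
    (κ := Kernel.id ×ₖ π.ker i)
  have hf4 := hf3.comp (f := fun x : Past B i × Win A L i × Win V T i => (x.2.1, x.2.2, x.1))
    (by fun_prop)
  simp only [Function.comp_def] at hf4
  unfold updateKernel updateJoint
  rw [Kernel.lintegral_map _ (by fun_prop) _ hf, Kernel.lintegral_comp _ _ _ hf1,
    Kernel.lintegral_comp _ _ _ hf1.lintegral_kernel,
    Kernel.lintegral_map _ (by fun_prop) _ hf3, Kernel.lintegral_id_prod hf4,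
    lintegral_map hf (by fun_prop), Measure.lintegral_compProd hf2]
  refine lintegral_congr fun ξ => ?_
  rw [Kernel.lintegral_id_prod hf1.lintegral_kernel,
    Kernel.lintegral_compProd _ _ _ (by fun_prop)]
  refine lintegral_congr fun a => ?_
  rw [Kernel.lintegral_id_prod hf1]
  rfl

instance (π : InputLT A B V L T) (i : ℕ) : IsFiniteKernel (m.updateKernel π i) := by
  have := Kernel.IsMarkovKernel.map (Kernel.id ×ₖ m.posteriorLT π i)
    (f := fun x : Past B i × Win A L i × Win V T i => (x.2.1, x.2.2, x.1)) (by fun_prop)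
  unfold updateKernel; infer_instance

variable [∀ j, StandardBorelSpace (B j)]

lemma hasCondDistrib_updateKernel (π : InputLT A B V L T) (i : ℕ) :
    HasCondDistrib (fun x => (last x.2.2, (m.aWin x, m.vWin x))) (fun x => (prev x).2.2)
      (m.updateKernel π i) (m.law (m.liftLT π) (i + 1)) := by
  have := Kernel.IsMarkovKernel.map (Kernel.id ×ₖ m.posteriorLT π i)
    (f := fun x : Past B i × Win A L i × Win V T i => (x.2.1, x.2.2, x.1)) (by fun_prop)
  have h0 := m.hasCondDistrib_posteriorLT π i
  rw [← map_prev_law] at h0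
  have h1 := hasCondDistrib_id_prod (by fun_prop) (by fun_prop)
    (hasCondDistrib_of_map measurable_prev (by fun_prop) (by fun_prop) h0)
  have h2 := h1.comp_left (f := fun x : Past B i × Win A L i × Win V T i => (x.2.1, x.2.2, x.1))
    (by fun_prop)
  have h3 := hasCondDistrib_id_prod (by fun_prop) (by fun_prop) (m.hasCondDistrib_inputLT π i)
  have h4 := hasCondDistrib_comp (by fun_prop) (by fun_prop)
    (g := fun x : Win A L i × Win V T i × Past B i => x.2.2) (by fun_prop) (fun _ => rfl) h2 h3
  have h5 := hasCondDistrib_id_prod (by fun_prop) (by fun_prop)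
    (m.hasCondDistrib_QWin (m.liftLT π) i)
  have h6 := hasCondDistrib_comp (by fun_prop) (by fun_prop)
    (g := fun x : (Win A L i × Win V T i × Past B i) × A (i : ℤ) => x.1.2.2) (by fun_prop)
    (fun _ => rfl) h4 h5
  have h7 := h6.comp_left
    (f := fun y => (y.2, ((m.nextWin y).1, (m.nextWin y).2.1))) (by fun_prop)
  rw [hasCondDistrib_iff (by fun_prop) (by fun_prop)] at h7 ⊢
  refine Eq.trans (Measure.map_congr ?_) h7
  filter_upwards [m.ae_nextWin (m.liftLT π) i] with x hx
  simp only [Function.comp_def, Prod.mk.injEq, true_and]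
  exact ⟨congrArg Prod.fst hx, congrArg (fun y => y.2.1) hx⟩

/-- The a posteriori distributions satisfy Bayes' recursion: both sides disintegrate the joint law
of `b_i` and `(a_{i+1-L}^i, v_{i+1-T}^i)` given `b^{i-1}`. -/
lemma posteriorLT_succ (π : InputLT A B V L T) (i : ℕ) :
    ∀ᵐ b ∂((m.law (m.liftLT π) i).map fun x => x.2.2), ∀ᵐ y ∂(m.outputLT π i b),
      m.posteriorLT π (i + 1) (append b y) = m.posteriorUpdate π i b y (m.posteriorLT π i b) := by
  have h1 := hasCondDistrib_comap (by fun_prop) (by fun_prop)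
    (g := fun p : Past B i × B (i : ℤ) => append p.1 p.2) (by fun_prop)
    (k := fun b => (dropLast b, last b)) (by fun_prop) (by simp)
    (m.hasCondDistrib_posteriorLT π (i + 1))
  have h2 := hasCondDistrib_compProd (by fun_prop) (by fun_prop) (by fun_prop)
    (m.hasCondDistrib_outputLT π i) h1
  have h3 := (m.hasCondDistrib_updateKernel π i).map_eq.symm.trans h2.map_eq
  have h4 := Kernel.ae_eq_of_compProd_eq h3
  have e : (m.law (m.liftLT π) (i + 1)).map (fun x => (prev x).2.2)
      = (m.law (m.liftLT π) i).map fun x => x.2.2 := by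
    rw [← m.map_prev_law _ i, Measure.map_map (by fun_prop) (by fun_prop)]
    rfl
  rw [e] at h4
  filter_upwards [h4] with b hb
  rw [updateKernel_apply, Kernel.compProd_apply_eq_compProd_sectR] at hb
  have key : ∀ (μ : Measure (B (i : ℤ) × (Win A L (i + 1) × Win V T (i + 1)))) [IsFiniteMeasure μ]
      (κ : Kernel (B (i : ℤ)) (Win A L (i + 1) × Win V T (i + 1))) [IsMarkovKernel κ],
      μ = m.outputLT π i b ⊗ₘ κ → μ.condKernel =ᵐ[m.outputLT π i b] κ := by
    intro μ _ κ _ h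
    subst h
    exact condKernel_compProd _ _
  filter_upwards [key _ _ hb] with y hy
  exact hy.symm

end Posterior

/-! ### Encoding strategies -/

section EncoderLaw

variable {A B V : ℤ → Type*} [∀ j, MeasurableSpace (A j)] [∀ j, MeasurableSpace (B j)]
  [∀ j, MeasurableSpace (V j)] {L M T : ℕ} (m : Model A B V L M T) {K : ℕ}

lemma lintegral_encLaw (g : EncoderD A B V K) (i : ℕ) (f : Hist A B V i → ℝ≥0∞) :
    ∫⁻ x, f x ∂m.encLaw g i = ∑ w, (K : ℝ≥0)⁻¹ • ∫⁻ x, f x ∂m.law (g.toInput w) i := by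
  unfold encLaw
  simp only [lintegral_finsetSum_measure, lintegral_smul_measure]

lemma sum_inv_smul_const [NeZero K] (a : ℝ≥0∞) : ∑ _w : Fin K, (K : ℝ≥0)⁻¹ • a = a := by
  have hK : (K : ℝ≥0) ≠ 0 := Nat.cast_ne_zero.2 (NeZero.ne K)
  rw [Finset.sum_const, Finset.card_univ, Fintype.card_fin, ← Nat.cast_smul_eq_nsmul ℝ≥0, smul_smul,
    mul_inv_cancel₀ hK, one_smul]

/-- The joint law of `(a^{i-1}, v^{i-1}, b^{i-1})` and `a_i` under an encoding strategy. -/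
def encInputLaw (g : EncoderD A B V K) (i : ℕ) : Measure (Hist A B V i × A (i : ℤ)) :=
  ∑ w : Fin K, (K : ℝ≥0)⁻¹ • (m.law (g.toInput w) i ⊗ₘ (g.toInput w).ker i)

instance (g : EncoderD A B V K) (i : ℕ) : IsFiniteMeasure (m.encInputLaw g i) := by
  unfold encInputLaw; infer_instance

lemma lintegral_encInputLaw (g : EncoderD A B V K) (i : ℕ)
    (f : Hist A B V i × A (i : ℤ) → ℝ≥0∞) :
    ∫⁻ x, f x ∂m.encInputLaw g i
      = ∑ w, (K : ℝ≥0)⁻¹ • ∫⁻ x, f x ∂(m.law (g.toInput w) i ⊗ₘ (g.toInput w).ker i) := by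
  unfold encInputLaw
  simp only [lintegral_finsetSum_measure, lintegral_smul_measure]

variable [∀ j, StandardBorelSpace (A j)] [∀ j, Nonempty (A j)]

/-- The input distributions induced by an encoding strategy with uniformly distributed messages. -/
def encInput (g : EncoderD A B V K) : InputD A B V where
  ker i := (m.encInputLaw g i).condKernel
  markov _ := inferInstance

/-- Averaging over the messages amounts to using the input distributions `encInput`. -/
lemma encLaw_eq_law [NeZero K] (g : EncoderD A B V K) : m.encLaw g = m.law (m.encInput g) := by
  funext i
  refine m.eq_law ?_ (fun i => ?_) i
  · refine Measure.ext_of_lintegral _ fun f hf => ?_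
    rw [lintegral_encLaw]
    simp only [law_zero]
    exact sum_inv_smul_const _
  · have h1 : (m.encInputLaw g i).fst = m.encLaw g i := by
      refine Measure.ext_of_lintegral _ fun f hf => ?_
      rw [Measure.fst, lintegral_map hf measurable_fst, lintegral_encInputLaw, lintegral_encLaw]
      refine Finset.sum_congr rfl fun w _ => ?_
      rw [← lintegral_map hf measurable_fst]
      congr 2
      exact Measure.fst_compProd _ _
    have h2 : m.encLaw g i ⊗ₘ (m.encInput g).ker i = m.encInputLaw g i := by
      rw [← h1]
      exact (m.encInputLaw g i).disintegrate (m.encInputLaw g i).condKernel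
    rw [h2]
    refine Measure.ext_of_lintegral _ fun f hf => ?_
    rw [lintegral_encLaw, lintegral_emit _ _ hf, lintegral_encInputLaw]
    refine Finset.sum_congr rfl fun w _ => ?_
    rw [law_succ, lintegral_emit _ _ hf]

variable [∀ j, StandardBorelSpace (B j)] [∀ j, StandardBorelSpace (V j)] [∀ j, Nonempty (B j)]
  [∀ j, Nonempty (V j)]

/-- An encoding strategy does no better than the input distributions it induces. -/
lemma encoderBound_le [NeZero K] (κ : ℝ≥0) (n : ℕ) :
    m.encoderBound κ K n ≤ m.capD κ n / (n + 1) := by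
  refine iSup₂_le fun g hg => ENNReal.div_le_div_right ?_ _
  have e := m.encLaw_eq_law g
  refine le_trans (le_of_eq ?_) (le_iSup₂_of_le (m.encInput g) (by rw [← e]; exact hg) le_rfl)
  simp only [sumInfo, info, e]

end EncoderLaw

section Replay

variable {A B V : ℤ → Type*} [∀ j, MeasurableSpace (A j)] [∀ j, MeasurableSpace (B j)]
  [∀ j, MeasurableSpace (V j)] {L M T : ℕ} (m : Model A B V L M T) {K : ℕ}
  (g : EncoderFB A B K)

/-- The history `(a^{i-1}, v^{i-1}, b^{i-1})` recovered from the message and the outputs `b^{i-1}`: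
inputs are computed by the feedback encoder, and the noise by inverting the channel. -/
def replay (w : Fin K) : (i : ℕ) → Past B i → Hist A B V i
  | 0, _ => emptyHist
  | i + 1, b =>
    let x := replay w i (dropLast b)
    let a := g.enc i w (x.1, x.2.2)
    snocHist x (a, m.hinv i (last b) (m.bWin x.2.2) (m.aWin x) a, last b)

@[simp] lemma replay_output (w : Fin K) (i : ℕ) (b : Past B i) : (m.replay g w i b).2.2 = b := by
  induction i with
  | zero => exact Subsingleton.elim _ _
  | succ i ih => simp [replay, snocHist, ih]

@[simp] lemma prev_replay (w : Fin K) (i : ℕ) (b : Past B (i + 1)) :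
    prev (m.replay g w (i + 1) b) = m.replay g w i (dropLast b) := by
  simp [replay]

lemma last_replay (w : Fin K) (i : ℕ) (b : Past B (i + 1)) :
    last (m.replay g w (i + 1) b).1
      = g.enc i w ((m.replay g w i (dropLast b)).1, dropLast b) := by
  simp [replay, snocHist]

@[fun_prop]
lemma measurable_replay (w : Fin K) (i : ℕ) : Measurable (m.replay g w i) := by
  induction i with
  | zero => exact measurable_const
  | succ i ih =>
    have h1 : Measurable fun b : Past B (i + 1) => m.replay g w i (dropLast b) :=
      ih.comp measurable_dropLast
    have h2 : Measurable fun b : Past B (i + 1) => g.enc i w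
        ((m.replay g w i (dropLast b)).1, (m.replay g w i (dropLast b)).2.2) :=
      (g.measurable_enc i w).comp (by fun_prop)
    simp only [replay]
    fun_prop

@[fun_prop]
lemma measurable_replay' (i : ℕ) :
    Measurable fun p : Fin K × Past B i => m.replay g p.1 i p.2 :=
  measurable_from_prod_countable_right fun w => m.measurable_replay g w i

/-- The input at time `i`, from the message and the outputs `b^{i-1}`. -/
def replayInput (i : ℕ) (p : Fin K × Past B i) : A (i : ℤ) :=
  g.enc i p.1 ((m.replay g p.1 i p.2).1, p.2)

@[fun_prop]
lemma measurable_replayInput (i : ℕ) : Measurable (m.replayInput g i) :=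
  measurable_from_prod_countable_right fun w => (g.measurable_enc i w).comp
    (f := fun b => ((m.replay g w i b).1, b)) (by fun_prop)

/-- The law of the message and the outputs `b^{i-1}`. -/
def msgLaw (i : ℕ) : Measure (Fin K × Past B i) :=
  ∑ w : Fin K, (K : ℝ≥0)⁻¹ • (m.law (g.toD.toInput w) i).map fun x => (w, x.2.2)

instance (i : ℕ) : IsFiniteMeasure (m.msgLaw g i) := by unfold msgLaw; infer_instance

lemma lintegral_msgLaw (i : ℕ) {f : Fin K × Past B i → ℝ≥0∞} (hf : Measurable f) :
    ∫⁻ p, f p ∂m.msgLaw g i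
      = ∑ w, (K : ℝ≥0)⁻¹ • ∫⁻ x, f (w, x.2.2) ∂m.law (g.toD.toInput w) i := by
  unfold msgLaw
  simp only [lintegral_finsetSum_measure, lintegral_smul_measure]
  refine Finset.sum_congr rfl fun w _ => ?_
  rw [lintegral_map hf (by fun_prop)]

instance [NeZero K] (i : ℕ) : IsProbabilityMeasure (m.msgLaw g i) := by
  constructor
  rw [← lintegral_one, lintegral_msgLaw _ _ _ measurable_const]
  simp only [lintegral_one, measure_univ]
  exact sum_inv_smul_const _

/-- The channel law of `b_i` given the message and the outputs `b^{i-1}`. -/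
def replayQ (i : ℕ) : Kernel (Fin K × Past B i) (B (i : ℤ)) :=
  (m.QHist i).comap (fun p => (m.replay g p.1 i p.2, m.replayInput g i p)) (by fun_prop)

instance (i : ℕ) : IsMarkovKernel (m.replayQ g i) := by unfold replayQ; infer_instance

lemma map_msgLaw (i : ℕ) :
    (m.msgLaw g (i + 1)).map (fun p => (p.1, dropLast p.2)) = m.msgLaw g i := by
  refine Measure.ext_of_lintegral _ fun f hf => ?_
  rw [lintegral_map hf (by fun_prop), lintegral_msgLaw _ _ _ (by fun_prop),
    lintegral_msgLaw _ _ _ hf]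
  refine Finset.sum_congr rfl fun w _ => ?_
  rw [← m.map_prev_law _ i, lintegral_map (by fun_prop) (by fun_prop)]
  rfl

variable [∀ j, StandardBorelSpace (A j)] [∀ j, StandardBorelSpace (V j)]

/-- Given the message, inputs and noise are functions of the outputs. -/
lemma ae_eq_replay (w : Fin K) (i : ℕ) :
    ∀ᵐ x ∂m.law (g.toD.toInput w) i, x = m.replay g w i x.2.2 := by
  induction i with
  | zero => exact ae_of_all _ fun x => Subsingleton.elim _ _
  | succ i ih =>
    have hprev := m.map_prev_law (g.toD.toInput w) i
    rw [← hprev] at ih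
    have h1 := ae_of_ae_map measurable_prev.aemeasurable ih
    have hg : Measurable fun x : Hist A B V i => g.enc i w (x.1, x.2.2) :=
      (g.measurable_enc i w).comp (by fun_prop)
    have hg' : Measurable fun q : Hist A B V i × A (i : ℤ) => g.enc i w (q.1.1, q.1.2.2) :=
      hg.comp measurable_fst
    have h2 : ∀ᵐ x ∂m.law (g.toD.toInput w) (i + 1),
        last x.1 = g.enc i w ((prev x).1, (prev x).2.2) := by
      refine ae_of_ae_map (f := fun x : Hist A B V (i + 1) => (prev x, last x.1))
        (p := fun q : Hist A B V i × A (i : ℤ) => q.2 = g.enc i w (q.1.1, q.1.2.2))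
        (Measurable.aemeasurable (by fun_prop)) ?_
      rw [(m.hasCondDistrib_input (g.toD.toInput w) i).map_eq]
      change ∀ᵐ q ∂((m.law (g.toD.toInput w) (i + 1)).map prev ⊗ₘ
        Kernel.deterministic (fun x => g.enc i w (x.1, x.2.2)) hg), _
      rw [Measure.compProd_deterministic, ae_map_iff (by fun_prop)
        (measurableSet_eq_fun measurable_snd hg')]
      exact ae_of_all _ fun _ => rfl
    have h3 : ∀ᵐ x ∂m.law (g.toD.toInput w) (i + 1), last x.2.1
        = m.hinv i (last x.2.2) (m.bWin (prev x).2.2) (m.aWin (prev x)) (last x.1) := by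
      rw [law_succ]
      refine m.ae_emit _ (measurableSet_eq_fun (by fun_prop) (by fun_prop)) fun x a v => ?_
      simp only [extend, prev_snocHist]
      simp only [snocHist, last_append, hinv_h]
    filter_upwards [h1, h2, h3] with x h1 h2 h3
    have hb : dropLast x.2.2 = (prev x).2.2 := rfl
    simp only [replay]
    rw [hb, ← h1, ← h2, ← h3]
    simp only [snocHist, prev, append_dropLast_last]

end Replay

/-! ### Converse -/

section Converse

variable {A B V : ℤ → Type*} [∀ j, MeasurableSpace (A j)] [∀ j, MeasurableSpace (B j)]
  [∀ j, MeasurableSpace (V j)] {L M T : ℕ} (m : Model A B V L M T) {K : ℕ}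
  (g : EncoderFB A B K)

/-- The law of the outputs `b^{i-1}`, averaged over the messages. -/
def outLaw (i : ℕ) : Measure (Past B i) := (m.encLaw g.toD i).map fun x => x.2.2

lemma map_snd_msgLaw (i : ℕ) : (m.msgLaw g i).map Prod.snd = m.outLaw g i := by
  refine Measure.ext_of_lintegral _ fun f hf => ?_
  rw [outLaw, lintegral_map hf (by fun_prop), lintegral_map hf (by fun_prop),
    lintegral_msgLaw _ _ _ (by fun_prop), lintegral_encLaw]

instance [NeZero K] (i : ℕ) : IsProbabilityMeasure (m.outLaw g i) := by
  rw [← map_snd_msgLaw]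
  exact Measure.isProbabilityMeasure_map (by fun_prop)

/-- The uniform distribution of the messages. -/
def unifMsg (K : ℕ) : Measure (Fin K) := ∑ w : Fin K, (K : ℝ≥0)⁻¹ • Measure.dirac w

lemma lintegral_unifMsg (f : Fin K → ℝ≥0∞) :
    ∫⁻ w, f w ∂unifMsg K = ∑ w, (K : ℝ≥0)⁻¹ • f w := by
  unfold unifMsg
  simp only [lintegral_finsetSum_measure, lintegral_smul_measure, lintegral_dirac]

instance [NeZero K] : IsProbabilityMeasure (unifMsg K) := by
  constructor
  rw [← lintegral_one, lintegral_unifMsg]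
  exact sum_inv_smul_const _

variable [∀ j, StandardBorelSpace (A j)] [∀ j, StandardBorelSpace (V j)]

lemma encLaw_eq_map_replay (i : ℕ) :
    m.encLaw g.toD i = (m.msgLaw g i).map fun p => m.replay g p.1 i p.2 := by
  refine Measure.ext_of_lintegral _ fun f hf => ?_
  rw [lintegral_map hf (by fun_prop), lintegral_msgLaw _ _ _ (by fun_prop), lintegral_encLaw]
  refine Finset.sum_congr rfl fun w _ => ?_
  congr 1
  refine lintegral_congr_ae ?_
  filter_upwards [m.ae_eq_replay g w i] with x hx
  exact congrArg f hx

lemma hasCondDistrib_replayQ (i : ℕ) :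
    HasCondDistrib (fun p => last p.2) (fun p => (p.1, dropLast p.2)) (m.replayQ g i)
      (m.msgLaw g (i + 1)) := by
  rw [hasCondDistrib_iff_lintegral (by fun_prop) (by fun_prop)]
  intro f hf
  have hf' := (hf.lintegral_kernel_prod_right' (κ := m.replayQ g i)).comp
    (f := fun p : Fin K × Past B (i + 1) => (p.1, dropLast p.2)) (by fun_prop)
  simp only [Function.comp_def] at hf'
  rw [lintegral_msgLaw _ _ _ (by fun_prop), lintegral_msgLaw _ _ _ hf']
  refine Finset.sum_congr rfl fun w _ => ?_
  congr 1
  have h := (hasCondDistrib_iff_lintegral (by fun_prop) (by fun_prop)).1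
    (m.hasCondDistrib_QHist (g.toD.toInput w) i)
    (fun q => f ((w, q.1.1.2.2), q.2)) (by fun_prop)
  refine h.trans (lintegral_congr_ae ?_)
  filter_upwards [m.ae_eq_replay g w (i + 1)] with x hx
  have e1 : prev x = m.replay g w i (prev x).2.2 := by
    conv_lhs => rw [hx, prev_replay]
    rfl
  have e2 : last x.1 = m.replayInput g i (w, (prev x).2.2) := by
    conv_lhs => rw [hx, last_replay]
    rfl
  have e3 : m.replayQ g i (w, (prev x).2.2) = m.QHist i (prev x, last x.1) := by
    rw [replayQ, Kernel.comap_apply, ← e1, ← e2]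
  rw [← e3]
  rfl

lemma msgLaw_succ (i : ℕ) :
    m.msgLaw g (i + 1)
      = (m.msgLaw g i ⊗ₘ m.replayQ g i).map fun p => (p.1.1, append p.1.2 p.2) := by
  have h2 := (m.hasCondDistrib_replayQ g i).map_eq
  rw [map_msgLaw] at h2
  rw [← h2, Measure.map_map (by fun_prop) (by fun_prop)]
  simp only [Function.comp_def, append_dropLast_last, Prod.mk.eta, Measure.map_id']

variable [∀ j, Nonempty (A j)] [∀ j, Nonempty (V j)]

/-- The output distribution of `b_i` given `b^{i-1}`, averaged over the messages. -/
def encOutput (i : ℕ) : Kernel (Past B i) (B (i : ℤ)) := m.outputD (m.encInput g.toD) i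

instance (i : ℕ) : IsMarkovKernel (m.encOutput g i) := by unfold encOutput; infer_instance

variable [NeZero K]

lemma hasCondDistrib_encOutput (i : ℕ) :
    HasCondDistrib (fun b => last b) (fun b => dropLast b) (m.encOutput g i)
      (m.outLaw g (i + 1)) := by
  unfold outLaw
  rw [m.encLaw_eq_law g.toD]
  exact hasCondDistrib_map (by fun_prop) (by fun_prop) (by fun_prop)
    (m.hasCondDistrib_outputD (m.encInput g.toD) i)

lemma outLaw_succ (i : ℕ) :
    m.outLaw g (i + 1) = (m.outLaw g i ⊗ₘ m.encOutput g i).map fun p => append p.1 p.2 := by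
  have h : (m.outLaw g (i + 1)).map dropLast = m.outLaw g i := by
    rw [← map_snd_msgLaw, ← map_snd_msgLaw, ← m.map_msgLaw g i, Measure.map_map (by fun_prop)
      (by fun_prop), Measure.map_map (by fun_prop) (by fun_prop)]
    rfl
  have h2 := (m.hasCondDistrib_encOutput g i).map_eq
  rw [h] at h2
  rw [← h2, Measure.map_map (by fun_prop) (by fun_prop)]
  simp only [Function.comp_def, append_dropLast_last, Measure.map_id']

/-- Recursion of the reference measure, under which outputs are independent of the message. -/
lemma unifMsg_prod_outLaw_succ (i : ℕ) :
    (unifMsg K).prod (m.outLaw g (i + 1))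
      = ((unifMsg K).prod (m.outLaw g i) ⊗ₘ (m.encOutput g i).comap Prod.snd measurable_snd).map
        fun p => (p.1.1, append p.1.2 p.2) := by
  refine Measure.ext_of_lintegral _ fun f hf => ?_
  have hf1 : Measurable fun p : (Fin K × Past B i) × B (i : ℤ) =>
    f (p.1.1, append p.1.2 p.2) := by fun_prop
  rw [lintegral_map hf (by fun_prop), Measure.lintegral_compProd hf1,
    lintegral_prod _ hf.aemeasurable, lintegral_prod _ (hf1.lintegral_kernel_prod_right'
      (κ := (m.encOutput g i).comap Prod.snd measurable_snd)).aemeasurable]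
  refine lintegral_congr fun w => ?_
  rw [outLaw_succ, lintegral_map (by fun_prop) (by fun_prop),
    Measure.lintegral_compProd (by fun_prop)]
  rfl

variable [∀ j, StandardBorelSpace (B j)] [∀ j, Nonempty (B j)]

/-- The `i`-th information term of a feedback code is the relative entropy, given the message and
the outputs `b^{i-1}`, of the channel law of `b_i` with respect to the output distribution. -/
lemma info_encLaw_eq_klDiv (i : ℕ) :
    m.info (m.encLaw g.toD) i = klDiv (m.msgLaw g i ⊗ₘ m.replayQ g i)
      (m.msgLaw g i ⊗ₘ (m.encOutput g i).comap Prod.snd measurable_snd) := by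
  have hφ : Measurable fun p : Fin K × Past B i => (p.2, ((m.aWin (m.replay g p.1 i p.2),
      m.replayInput g i p), m.vWin (m.replay g p.1 i p.2))) := by fun_prop
  have hQ : m.replayQ g i = (m.QInfo i).comap (fun p : Fin K × Past B i => (p.2,
      ((m.aWin (m.replay g p.1 i p.2), m.replayInput g i p), m.vWin (m.replay g p.1 i p.2))))
      hφ := by
    ext p : 1
    simp only [replayQ, QInfo, QHist, Kernel.comap_apply, replay_output]
  have hq := m.hasCondDistrib_replayQ g i
  have hη : HasCondDistrib (fun p : Fin K × Past B (i + 1) => last p.2) (fun p => dropLast p.2)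
      (m.encOutput g i) (m.msgLaw g (i + 1)) := by
    have := m.hasCondDistrib_encOutput g i
    rw [← map_snd_msgLaw] at this
    exact hasCondDistrib_of_map (by fun_prop) (by fun_prop) (by fun_prop) this
  have h1 : m.info (m.encLaw g.toD) i = condMutualInfo (m.msgLaw g (i + 1))
      (fun p => ((m.aWin (m.replay g p.1 i (dropLast p.2)),
        m.replayInput g i (p.1, dropLast p.2)), m.vWin (m.replay g p.1 i (dropLast p.2))))
      (fun p => last p.2) (fun p => dropLast p.2) := by
    refine condMutualInfo_congr (by fun_prop) (by fun_prop) (by fun_prop) (by fun_prop)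
      (by fun_prop) (by fun_prop) ?_
    rw [encLaw_eq_map_replay, Measure.map_map (by fun_prop) (by fun_prop)]
    congr 1
    funext p
    simp only [Function.comp_apply, prev_replay, replay_output, last_replay]
    rfl
  rw [h1, ← m.map_msgLaw g i, klDiv_compProd_eq_expLogDensity (by fun_prop) (by fun_prop) hq]
  simp only [hQ] at hq ⊢
  exact condMutualInfo_eq_expLogDensity
    (s := fun p : Fin K × Past B (i + 1) => (p.1, dropLast p.2)) (q := m.QInfo i)
    (by fun_prop) (by fun_prop) (by fun_prop) (by fun_prop) hφ (fun _ => rfl) hq hη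

/-- The mutual information between the message and the outputs `b^{i-1}` is at most the sum of the
information terms, by the chain rule. -/
lemma klDiv_msgLaw_le (i : ℕ) :
    klDiv (m.msgLaw g i) ((unifMsg K).prod (m.outLaw g i))
      ≤ ∑ j ∈ Finset.range i, m.info (m.encLaw g.toD) j := by
  induction i with
  | zero =>
    have : m.msgLaw g 0 = (unifMsg K).prod (m.outLaw g 0) := by
      refine Measure.ext_of_lintegral _ fun f hf => ?_
      rw [lintegral_msgLaw _ _ _ hf, lintegral_prod _ hf.aemeasurable, lintegral_unifMsg]
      refine Finset.sum_congr rfl fun w _ => ?_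
      congr 1
      rw [outLaw, encLaw_eq_law, lintegral_map (by fun_prop) (by fun_prop), law_zero, law_zero]
    rw [this, klDiv_self]
    exact zero_le
  | succ i ih =>
    rw [msgLaw_succ, unifMsg_prod_outLaw_succ, Finset.sum_range_succ, info_encLaw_eq_klDiv]
    refine (klDiv_map_le _ _ (by fun_prop)).trans ?_
    rw [klDiv_compProd_eq_add]
    gcongr

end Converse

section Codes

variable {A B V : ℤ → Type*} [∀ j, MeasurableSpace (A j)] [∀ j, MeasurableSpace (B j)]
  [∀ j, MeasurableSpace (V j)] {L M T : ℕ} {m : Model A B V L M T}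
  [∀ j, StandardBorelSpace (A j)] [∀ j, StandardBorelSpace (B j)]
  [∀ j, StandardBorelSpace (V j)] [∀ j, Nonempty (A j)] [∀ j, Nonempty (B j)]
  [∀ j, Nonempty (V j)]

/-- Fano's inequality for a feedback code. -/
lemma Code.rate_mul_le {κ : ℝ≥0} {n : ℕ} (c : m.Code κ n) :
    c.rate * (1 - c.errorProb)
      ≤ m.encoderBound κ c.K n + ENNReal.ofReal (Real.log 2 / (n + 1)) := by
  have : NeZero c.K := ⟨c.K_pos.ne'⟩
  set I := m.sumInfo (m.encLaw c.enc.toD) n with hI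
  have hIle : I / (n + 1) ≤ m.encoderBound κ c.K n :=
    le_iSup₂_of_le (f := fun (g : EncoderD A B V c.K) (_ : m.avgCost (m.encLaw g) n ≤ κ) =>
      m.sumInfo (m.encLaw g) n / (n + 1)) c.enc.toD c.cost_le le_rfl
  refine le_trans ?_ (add_le_add_left hIle _)
  -- an infinite information term makes the bound trivial
  by_cases hItop : I = ⊤
  · rw [hItop, ENNReal.top_div_of_ne_top (by finiteness)]
    simp
  have hkl := m.klDiv_msgLaw_le c.enc (n + 1)
  change _ ≤ I at hkl
  have hklne := ne_top_of_le_ne_top hItop hkl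
  let E : Set (Fin c.K × Past B (n + 1)) := {p | c.dec p.2 = p.1}
  have hE : MeasurableSet E :=
    measurableSet_eq_fun (c.measurable_dec.comp measurable_snd) measurable_fst
  have hK1 : (1 : ℝ) ≤ c.K := by exact_mod_cast c.K_pos
  -- the decoder succeeds with probability `1 / K` if outputs are independent of the message
  have hν : ((unifMsg c.K).prod (m.outLaw c.enc (n + 1))).real E = (c.K : ℝ)⁻¹ := by
    have h1 : ((unifMsg c.K).prod (m.outLaw c.enc (n + 1))) E = (c.K : ℝ≥0∞)⁻¹ := by
      rw [Measure.prod_apply_symm hE]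
      have h2 : ∀ b, unifMsg c.K ((fun w => (w, b)) ⁻¹' E) = (c.K : ℝ≥0∞)⁻¹ := by
        intro b
        rw [← lintegral_indicator_one (MeasurableSet.of_discrete), lintegral_unifMsg,
          Finset.sum_eq_single (c.dec b)]
        · rw [Set.indicator_of_mem (by simp [E])]
          simp [ENNReal.smul_def, ENNReal.coe_inv (Nat.cast_ne_zero.2 c.K_pos.ne')]
        · intro w _ hw
          have hwE : w ∉ (fun w => (w, b)) ⁻¹' E := fun h : c.dec b = w => hw h.symm
          rw [Set.indicator_of_notMem hwE]
          simp
        · simp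
      simp [h2]
    rw [measureReal_def, h1]
    simp
  have hμ : m.msgLaw c.enc (n + 1) Eᶜ = c.errorProb := by
    rw [← lintegral_indicator_one hE.compl, lintegral_msgLaw _ _ _
      (measurable_one.indicator hE.compl), Code.errorProb, ENNReal.div_eq_inv_mul, Finset.mul_sum]
    refine Finset.sum_congr rfl fun w _ => ?_
    have h3 : MeasurableSet {x : Hist A B V (n + 1) | c.dec x.2.2 ≠ w} :=
      (measurableSet_eq_fun (c.measurable_dec.comp (by fun_prop)) measurable_const).compl
    rw [← lintegral_indicator_one h3, ENNReal.smul_def,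
      ENNReal.coe_inv (Nat.cast_ne_zero.2 c.K_pos.ne')]
    rfl
  have hμ' : m.msgLaw c.enc (n + 1) E = 1 - c.errorProb := by
    rw [← hμ, prob_compl_eq_one_sub hE, ENNReal.sub_sub_cancel ENNReal.one_ne_top prob_le_one]
  have hF := measureReal_mul_log_le_klDiv hE hK1 hν hklne
  have hklI := ENNReal.toReal_mono hItop hkl
  have hn : (0 : ℝ) < n + 1 := by positivity
  have hlog : 0 ≤ Real.log c.K := Real.log_nonneg hK1
  have hIdiv : I / (n + 1) = ENNReal.ofReal (I.toReal / (n + 1)) := by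
    rw [ENNReal.ofReal_div_of_pos hn, ENNReal.ofReal_toReal hItop]
    congr 1
    exact_mod_cast (ENNReal.ofReal_natCast (n + 1)).symm
  rw [hIdiv, ← hμ', ← ENNReal.ofReal_add (by positivity) (by positivity), Code.rate,
    ← ofReal_measureReal (measure_ne_top _ _), ← ENNReal.ofReal_mul (by positivity)]
  refine ENNReal.ofReal_le_ofReal ?_
  rw [← add_div, div_mul_eq_mul_div]
  gcongr
  linarith

lemma liminf_rate_le {κ : ℝ≥0} {c : (n : ℕ) → m.Code κ n} (hc : m.Reliable c) :
    liminf (fun n => (c n).rate) atTop ≤ liminf (fun n => m.encoderBound κ (c n).K n) atTop := by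
  obtain ⟨ε, hε, hle⟩ := hc
  have he : Tendsto (fun n => (c n).errorProb) atTop (𝓝 0) := by
    refine tendsto_of_tendsto_of_tendsto_of_le_of_le tendsto_const_nhds ?_
      (fun _ => zero_le) hle
    simpa using ENNReal.tendsto_ofReal hε
  have hd : Tendsto (fun n : ℕ => ENNReal.ofReal (Real.log 2 / (n + 1))) atTop (𝓝 0) := by
    have := ENNReal.tendsto_ofReal ((tendsto_const_div_atTop_nhds_zero_nat (Real.log 2)).comp
      (tendsto_add_atTop_nat 1))
    simpa using this
  -- for `s` below the limit inferior of the rates, `s * (1 - error) - (log 2) / (n + 1)` tends to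
  -- `s` and is eventually at most `encoderBound`
  refine le_of_forall_lt fun r hr => ?_
  obtain ⟨s, hrs, hs⟩ := exists_between hr
  have hs_top : s ≠ ⊤ := hs.ne_top
  have hev := eventually_lt_of_lt_liminf hs
  have hlim : Tendsto (fun n : ℕ => s * (1 - (c n).errorProb)
      - ENNReal.ofReal (Real.log 2 / (n + 1))) atTop (𝓝 s) := by
    have h1 : Tendsto (fun n : ℕ => s * (1 - (c n).errorProb)) atTop (𝓝 (s * (1 - 0))) :=
      ENNReal.Tendsto.const_mul (ENNReal.Tendsto.sub tendsto_const_nhds he (by simp))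
        (Or.inr hs_top)
    have h2 := ENNReal.Tendsto.sub h1 hd (by simp)
    simpa using h2
  refine hrs.trans_le ?_
  rw [← hlim.liminf_eq]
  refine liminf_le_liminf ?_
  filter_upwards [hev] with n hn
  rw [tsub_le_iff_right]
  exact (mul_le_mul_left hn.le _).trans (c n).rate_mul_le

lemma liminf_encoderBound_le {κ : ℝ≥0} (c : (n : ℕ) → m.Code κ n) :
    liminf (fun n => m.encoderBound κ (c n).K n) atTop
      ≤ liminf (fun n : ℕ => m.capD κ n / (n + 1)) atTop := by
  refine liminf_le_liminf (Eventually.of_forall fun n => ?_)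
  have : NeZero (c n).K := ⟨(c n).K_pos.ne'⟩
  exact m.encoderBound_le κ n

end Codes

end Model

end NCMD

end

theorem mainTheorem2 {A B V : ℤ → Type*}
    [∀ j, MeasurableSpace (A j)] [∀ j, MeasurableSpace (B j)] [∀ j, MeasurableSpace (V j)]
    [∀ j, StandardBorelSpace (A j)] [∀ j, StandardBorelSpace (B j)]
    [∀ j, StandardBorelSpace (V j)]
    [∀ j, Nonempty (A j)] [∀ j, Nonempty (B j)] [∀ j, Nonempty (V j)]
    {L M T : ℕ} (m : NCMD.Model A B V L M T) (κ : ℝ≥0) :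
    -- (1) converse coding theorem
    ((∀ n, ∃ p, m.IsOptimal κ n p) →
      liminf (fun n : ℕ => m.capD κ n / (n + 1)) atTop ≠ ⊤ →
      (∀ c : (n : ℕ) → m.Code κ n, m.Reliable c →
        liminf (fun n => (c n).rate) atTop
            ≤ liminf (fun n => m.encoderBound κ (c n).K n) atTop ∧
          liminf (fun n => m.encoderBound κ (c n).K n) atTop
            ≤ liminf (fun n : ℕ => m.capD κ n / (n + 1)) atTop) ∧
      ∀ R : ℝ, m.Achievable κ R →
        ENNReal.ofReal R ≤ liminf (fun n : ℕ => m.capD κ n / (n + 1)) atTop) ∧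
    -- the information terms are expected logarithms of densities of the channel distributions
    -- with respect to the output distributions, under the joint law
    (∀ (p : NCMD.InputD A B V) (i : ℕ),
      m.law p i = m.factorLaw p i ∧
      HasCondDistrib (fun x => NCMD.last x.2.2) (fun x => (NCMD.prev x).2.2) (m.outputD p i)
        (m.law p (i + 1)) ∧
      m.info (m.law p) i = m.expLogD p i) ∧
    -- past noise is redundant for the encoder that knows past inputs and outputs
    (∀ n, m.capD κ n = m.capC κ n) ∧
    -- (2) information structures
    (∀ (n : ℕ) (p : NCMD.InputD A B V), m.IsOptimal κ n p →
      ∃ π : NCMD.InputLT A B V L T,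
        (∀ i ≤ n, HasCondDistrib (fun x => NCMD.last x.1)
          (fun x => (m.aWin (NCMD.prev x), m.vWin (NCMD.prev x), (NCMD.prev x).2.2))
          (π.ker i) (m.law p (i + 1))) ∧
        m.IsOptimal κ n (m.liftLT π)) ∧
    (∀ n, m.capD κ n = m.capLT κ n) ∧
    (∀ (π : NCMD.InputLT A B V L T) (i : ℕ),
      m.law (m.liftLT π) i = m.factorLaw (m.liftLT π) i ∧
      HasCondDistrib (fun x => NCMD.last x.2.2) (fun x => (NCMD.prev x).2.2) (m.outputLT π i)
        (m.law (m.liftLT π) (i + 1)) ∧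
      m.info (m.law (m.liftLT π)) i = m.expLogLT π i ∧
      -- the recursion of the a posteriori distributions
      m.posteriorLT π 0 = Kernel.const _ (Measure.dirac (m.a0, m.v0)) ∧
      ∀ᵐ b ∂((m.law (m.liftLT π) i).map fun x => x.2.2), ∀ᵐ y ∂(m.outputLT π i b),
        m.posteriorLT π (i + 1) (NCMD.append b y)
          = m.posteriorUpdate π i b y (m.posteriorLT π i b)) := by
  refine ⟨fun _ _ => ⟨fun c hc => ⟨NCMD.Model.liminf_rate_le hc,
      NCMD.Model.liminf_encoderBound_le c⟩, ?_⟩, fun p i => ⟨m.law_eq_factorLaw p i,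
      m.hasCondDistrib_outputD p i, m.info_eq_expLogD p i⟩, fun n => m.capD_eq_capC κ n,
    fun n p hp => ⟨m.toLT p, fun i _ => m.hasCondDistrib_toLT p i, m.isOptimal_toLT hp⟩,
    fun n => m.capD_eq_capLT κ n, fun π i => ⟨m.law_eq_factorLaw _ i,
      m.hasCondDistrib_outputLT π i, m.info_eq_expLogLT π i, m.posteriorLT_zero π,
      m.posteriorLT_succ π i⟩⟩
  rintro R ⟨c, hc, hR⟩
  exact hR.trans ((NCMD.Model.liminf_rate_le hc).trans (NCMD.Model.liminf_encoderBound_le c))
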